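/- Let $N\in\{2,3\}$ and let $\Omega\subset\mathbb R^N$ be a bounded convex open set. Let $d_n,c_n,d_p,c_p>0$ be constants, $D\in L^\infty(\Omega)$, and $(a_u,a_n,a_p)\in H^2(\Omega)\times H^1(\Omega)\times H^1(\Omega)$. Equip $H^1_0(\Omega)$ (the closure of $C_c^\infty(\Omega)$ in $H^1(\Omega)$) with the norm $\|f\|_{H^1_0}=\|\nabla f\|_{L^2}$, let $H^{-1}(\Omega)$ be its dual with the dual norm, and set $$\mathcal H=(H^2(\Omega)\cap H^1_0(\Omega))\times H^1_0(\Omega)\times H^1_0(\Omega),\qquad \mathcal G=L^2(\Omega)\times H^{-1}(\Omega)\times H^{-1}(\Omega).$$ For $h=(\rho,\sigma,\tau)\in\mathcal H$ write $(u,n,p)=(\rho,\sigma,\tau)+(a_u,a_n,a_p)$, and for $\lambda\in[0,1]$ let $F(h,\lambda)=(F_1,F_2,F_3)$, where $$F_1=-\nabla^2u+\lambda(n-p)-D\in L^2(\Omega),$$ $$F_2[\phi]=\int_\Omega(d_n\nabla n-c_n n\nabla u)\cdot\nabla\phi\,dx,\qquad F_3[\psi]=\int_\Omega(d_p\nabla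 p+c_p p\nabla u)\cdot\nabla\psi\,dx\qquad(\phi,\psi\in H^1_0(\Omega)).$$ Then: 1. $F:\mathcal H\times[0,1]\to\mathcal G$ is well defined: the fields $d_n\nabla n-c_n n\nabla u$ and $d_p\nabla p+c_p p\nabla u$ belong to $L^2(\Omega;\mathbb R^N)$, so that the integrals above converge and define elements of $H^{-1}(\Omega)$. 2. For every $(h,\lambda)\in\mathcal H\times[0,1]$ the map $F(\cdot,\lambda)$ is Fréchet differentiable at $h$. Its derivative $F_h(h,\lambda)\in B[\mathcal H,\mathcal G]$ depends continuously, in the operator norm, on $(h,\lambda)\in\mathcal H\times[0,1]$. 3. For all $(h,\lambda)\in\mathcal H\times[0,1]$, $h'=(\rho',\sigma',\tau')\in\mathcal H$ and $\phi,\psi\in H^1_0(\Omega)$, the components of $F_h(h,\lambda)h'$ are $$F_{1,h}(\rho',\sigma',\tau')=-\nabla^2\rho'+\lambda(\sigma'-\tau'),$$ $$F_{2,h}(\rho',\sigma',\tau')[\phi]=\int_\Omega(d_n\nabla\sigma'-c_n\sigma'\nabla u-c_n n\nabla\rho')\cdot\nabla\phi\,dx,$$ $$F_{3,h}(\rho',\sigma',\tau')[\psi]=\int_\Omega(d_p\nabla\tau'+c_p\tau'\nabla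 u+c_p p\nabla\rho')\cdot\nabla\psi\,dx,$$ where the integrands are integrable. -/

import Mathlib

open MeasureTheory Set
open scoped ContDiff Gradient InnerProductSpace ENNReal

noncomputable section

namespace DriftDiffusion

/-- Euclidean space `ℝ^N`. -/
abbrev Sp (N : ℕ) : Type := EuclideanSpace ℝ (Fin N)

/-- A bounded convex open set of `ℝ^N`, where `N = 2` or `N = 3`. -/
structure Domain (N : ℕ) where
  /-- The underlying set. -/
  carrier : Set (Sp N)
  dim : N = 2 ∨ N = 3
  isOpen : IsOpen carrier
  convex : Convex ℝ carrier
  isBounded : Bornology.IsBounded carrier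

variable {N : ℕ}

/-- Lebesgue measure on `Ω`. -/
abbrev Domain.vol (Ω : Domain N) : Measure (Sp N) := volume.restrict Ω.carrier

instance instIsFiniteMeasureVol (Ω : Domain N) : IsFiniteMeasure Ω.vol :=
  isFiniteMeasure_restrict.2 Ω.isBounded.measure_lt_top.ne

/-- `L²(Ω; V)`. -/
abbrev L2 (Ω : Domain N) (V : Type) [NormedAddCommGroup V] : Type := Lp V 2 Ω.vol

/-! ### Sobolev spaces -/

/-- `φ ∈ C_c^∞(Ω)`. -/
structure IsTest (Ω : Domain N) (φ : Sp N → ℝ) : Prop where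
  smooth : ContDiff ℝ ∞ φ
  compact : HasCompactSupport φ
  support : tsupport φ ⊆ Ω.carrier

/-- `g` is the weak partial derivative `∂ᵢ f` on `Ω`. -/
def IsWeakPartial (Ω : Domain N) (i : Fin N) (f g : Sp N → ℝ) : Prop :=
  ∀ φ, IsTest Ω φ →
    ∫ x in Ω.carrier, f x * fderiv ℝ φ x (EuclideanSpace.single i 1)
      = -∫ x in Ω.carrier, g x * φ x

theorem IsTest.memLp {Ω : Domain N} {φ : Sp N → ℝ} (h : IsTest Ω φ) : MemLp φ 2 Ω.vol :=
  (h.smooth.continuous.memLp_of_hasCompactSupport h.compact).restrict _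

theorem IsTest.memLp_fderiv {Ω : Domain N} {φ : Sp N → ℝ} (h : IsTest Ω φ) (v : Sp N) :
    MemLp (fun x => fderiv ℝ φ x v) 2 Ω.vol :=
  (((h.smooth.continuous_fderiv (by simp)).clm_apply
    continuous_const).memLp_of_hasCompactSupport (h.compact.fderiv_apply ℝ v)).restrict _

theorem IsTest.zero (Ω : Domain N) : IsTest Ω (0 : Sp N → ℝ) :=
  ⟨contDiff_const, HasCompactSupport.zero, by simp⟩

theorem IsTest.add {Ω : Domain N} {φ ψ : Sp N → ℝ} (h : IsTest Ω φ) (k : IsTest Ω ψ) :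
    IsTest Ω (φ + ψ) :=
  ⟨h.smooth.add k.smooth, h.compact.add k.compact,
    (tsupport_add φ ψ).trans (union_subset h.support k.support)⟩

theorem IsTest.smul {Ω : Domain N} {φ : Sp N → ℝ} (c : ℝ) (h : IsTest Ω φ) :
    IsTest Ω (c • φ) :=
  ⟨h.smooth.const_smul c, h.compact.smul_left (f := fun _ => c),
    (tsupport_smul_subset_right (fun _ => c) φ).trans h.support⟩

theorem IsWeakPartial.congr {Ω : Domain N} {i : Fin N} {f g f' g' : Sp N → ℝ}
    (h : IsWeakPartial Ω i f g) (hf : f' =ᵐ[Ω.vol] f) (hg : g' =ᵐ[Ω.vol] g) :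
    IsWeakPartial Ω i f' g' := by
  intro φ hφ
  rw [integral_congr_ae (g := fun x => f x * fderiv ℝ φ x (EuclideanSpace.single i 1)),
    integral_congr_ae (f := fun x => g' x * φ x) (g := fun x => g x * φ x)]
  · exact h φ hφ
  · filter_upwards [hg] with x hx; rw [hx]
  · filter_upwards [hf] with x hx; rw [hx]

theorem IsWeakPartial.zero (Ω : Domain N) (i : Fin N) : IsWeakPartial Ω i 0 0 := by
  intro φ _; simp

theorem IsWeakPartial.add {Ω : Domain N} {i : Fin N} {f g f' g' : Sp N → ℝ}
    (h : IsWeakPartial Ω i f g) (h' : IsWeakPartial Ω i f' g')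
    (hf : MemLp f 2 Ω.vol) (hg : MemLp g 2 Ω.vol)
    (hf' : MemLp f' 2 Ω.vol) (hg' : MemLp g' 2 Ω.vol) :
    IsWeakPartial Ω i (f + f') (g + g') := by
  intro φ hφ
  have e1 := h φ hφ
  have e2 := h' φ hφ
  have d := hφ.memLp_fderiv (EuclideanSpace.single i 1)
  simp only [Pi.add_apply, add_mul]
  have a1 := integral_add (hf.integrable_mul d) (hf'.integrable_mul d)
  have a2 := integral_add (hg.integrable_mul hφ.memLp) (hg'.integrable_mul hφ.memLp)
  simp only [Pi.mul_apply] at a1 a2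
  rw [a1, a2, e1, e2]
  ring

theorem IsWeakPartial.smul {Ω : Domain N} {i : Fin N} {f g : Sp N → ℝ} (c : ℝ)
    (h : IsWeakPartial Ω i f g) : IsWeakPartial Ω i (c • f) (c • g) := by
  intro φ hφ
  have e1 := h φ hφ
  simp only [Pi.smul_apply, smul_eq_mul, mul_assoc]
  rw [integral_const_mul, integral_const_mul, e1]
  ring

theorem memLp_coord {Ω : Domain N} {ι : Type} [Fintype ι] (g : L2 Ω (EuclideanSpace ℝ ι))
    (i : ι) : MemLp (fun x => g x i) 2 Ω.vol :=
  (Lp.memLp g).continuousLinearMap_comp (EuclideanSpace.proj (𝕜 := ℝ) i)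

/-- The pairs `(f, ∇f)` with `f ∈ L²(Ω)` and weak gradient `∇f ∈ L²(Ω; ℝ^N)`. -/
def h1Submodule (Ω : Domain N) : Submodule ℝ (WithLp 2 (L2 Ω ℝ × L2 Ω (Sp N))) where
  carrier := {z | ∀ i, IsWeakPartial Ω i z.fst (fun x => z.snd x i)}
  zero_mem' i := (IsWeakPartial.zero Ω i).congr (Lp.coeFn_zero ..) (by
    filter_upwards [Lp.coeFn_zero (Sp N) 2 Ω.vol] with x hx
    simp only [WithLp.zero_snd, hx, Pi.zero_apply, PiLp.zero_apply])
  add_mem' {z w} hz hw i := ((hz i).add (hw i) (Lp.memLp _) (memLp_coord _ i) (Lp.memLp _)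
    (memLp_coord _ i)).congr (Lp.coeFn_add ..) (by
      filter_upwards [Lp.coeFn_add z.snd w.snd] with x hx
      simp only [WithLp.add_snd, hx, Pi.add_apply, PiLp.add_apply])
  smul_mem' c z hz i := ((hz i).smul c).congr (Lp.coeFn_smul ..) (by
      filter_upwards [Lp.coeFn_smul c z.snd] with x hx
      simp only [WithLp.smul_snd, hx, Pi.smul_apply, PiLp.smul_apply])

/-- The Sobolev space `H¹(Ω)`, with `‖f‖² = ‖f‖²_{L²} + ‖∇f‖²_{L²}`. -/
abbrev H1 (Ω : Domain N) : Type := h1Submodule Ω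

instance instNormedAddCommGroupH1 (Ω : Domain N) : NormedAddCommGroup (H1 Ω) :=
  inferInstance

set_option synthInstance.maxHeartbeats 200000 in
instance instNormedSpaceH1 (Ω : Domain N) : NormedSpace ℝ (H1 Ω) :=
  inferInstance

/-- The function underlying an element of `H¹(Ω)`. -/
def H1.val {Ω : Domain N} (f : H1 Ω) : L2 Ω ℝ := f.1.fst

/-- The weak gradient of an element of `H¹(Ω)`. -/
def H1.grad {Ω : Domain N} (f : H1 Ω) : L2 Ω (Sp N) := f.1.snd

/-- The pairs `(f, D²f)` with `f ∈ H¹(Ω)` and weak Hessian `D²f ∈ L²(Ω; ℝ^{N×N})`. -/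
def h2Submodule (Ω : Domain N) :
    Submodule ℝ (WithLp 2 (H1 Ω × L2 Ω (EuclideanSpace ℝ (Fin N × Fin N)))) where
  carrier := {z | ∀ i j,
    IsWeakPartial Ω j (fun x => z.fst.grad x i) (fun x => z.snd x (i, j))}
  zero_mem' i j := (IsWeakPartial.zero Ω j).congr (by
      filter_upwards [Lp.coeFn_zero (Sp N) 2 Ω.vol] with x hx
      change ((0 : L2 Ω (Sp N)) x) i = 0
      simp only [hx, Pi.zero_apply, PiLp.zero_apply]) (by
      filter_upwards [Lp.coeFn_zero (EuclideanSpace ℝ (Fin N × Fin N)) 2 Ω.vol] with x hx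
      simp only [WithLp.zero_snd, hx, Pi.zero_apply, PiLp.zero_apply])
  add_mem' {z w} hz hw i j := ((hz i j).add (hw i j) (memLp_coord _ i) (memLp_coord _ (i, j))
    (memLp_coord _ i) (memLp_coord _ (i, j))).congr (by
      filter_upwards [Lp.coeFn_add z.fst.grad w.fst.grad] with x hx
      change ((z.fst.grad + w.fst.grad : L2 Ω (Sp N)) x) i = _
      simp only [hx, Pi.add_apply, PiLp.add_apply]) (by
      filter_upwards [Lp.coeFn_add z.snd w.snd] with x hx
      simp only [WithLp.add_snd, hx, Pi.add_apply, PiLp.add_apply])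
  smul_mem' c z hz i j := ((hz i j).smul c).congr (by
      filter_upwards [Lp.coeFn_smul c z.fst.grad] with x hx
      change ((c • z.fst.grad : L2 Ω (Sp N)) x) i = _
      simp only [hx, Pi.smul_apply, PiLp.smul_apply]) (by
      filter_upwards [Lp.coeFn_smul c z.snd] with x hx
      simp only [WithLp.smul_snd, hx, Pi.smul_apply, PiLp.smul_apply])

/-- The Sobolev space `H²(Ω)`, with `‖f‖² = ‖f‖²_{L²} + ‖∇f‖²_{L²} + ‖D²f‖²_{L²}`. -/
abbrev H2 (Ω : Domain N) : Type := h2Submodule Ω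

instance instNormedAddCommGroupH2 (Ω : Domain N) : NormedAddCommGroup (H2 Ω) :=
  inferInstance

set_option synthInstance.maxHeartbeats 200000 in
instance instNormedSpaceH2 (Ω : Domain N) : NormedSpace ℝ (H2 Ω) :=
  inferInstance

/-- The inclusion `H²(Ω) ⊆ H¹(Ω)`. -/
def H2.toH1 (Ω : Domain N) : H2 Ω →L[ℝ] H1 Ω :=
  (WithLp.fstL 2 ℝ _ _).comp (h2Submodule Ω).subtypeL

/-- The weak gradient of an element of `H²(Ω)`. -/
def H2.grad {Ω : Domain N} (f : H2 Ω) : L2 Ω (Sp N) := (H2.toH1 Ω f).grad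

/-- The weak Hessian of an element of `H²(Ω)`. -/
def H2.hess {Ω : Domain N} (f : H2 Ω) : L2 Ω (EuclideanSpace ℝ (Fin N × Fin N)) := f.1.snd

/-- The Laplacian `∇²f ∈ L²(Ω)` of `f ∈ H²(Ω)`: the trace of the weak Hessian. -/
def H2.laplacian {Ω : Domain N} (f : H2 Ω) : L2 Ω ℝ :=
  ∑ i : Fin N, (EuclideanSpace.proj (𝕜 := ℝ) (i, i)).compLp f.hess

/-- The elements `(φ, ∇φ)` of `H¹(Ω)` with `φ ∈ C_c^∞(Ω)`. -/
def testSubmodule (Ω : Domain N) : Submodule ℝ (H1 Ω) where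
  carrier := {f | ∃ φ, IsTest Ω φ ∧ f.val =ᵐ[Ω.vol] φ ∧ f.grad =ᵐ[Ω.vol] ∇ φ}
  zero_mem' := ⟨0, IsTest.zero Ω, Lp.coeFn_zero .., (Lp.coeFn_zero ..).trans (by
    have : ∇ (0 : Sp N → ℝ) = 0 := by
      funext x; exact gradient_const x (0 : ℝ)
    rw [this])⟩
  add_mem' := by
    rintro f g ⟨φ, hφ, a, b⟩ ⟨ψ, hψ, c, d⟩
    refine ⟨φ + ψ, hφ.add hψ, (Lp.coeFn_add f.val g.val).trans (a.add c),
      (Lp.coeFn_add f.grad g.grad).trans ((b.add d).trans (Filter.EventuallyEq.of_eq ?_))⟩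
    funext x
    simp only [Pi.add_apply, gradient]
    rw [fderiv_add (hφ.smooth.differentiable (by simp) x)
      (hψ.smooth.differentiable (by simp) x), map_add]
  smul_mem' := by
    rintro c f ⟨φ, hφ, a, b⟩
    refine ⟨c • φ, hφ.smul c, (Lp.coeFn_smul c f.val).trans (a.const_smul c),
      (Lp.coeFn_smul c f.grad).trans ((b.const_smul c).trans (Filter.EventuallyEq.of_eq ?_))⟩
    funext x
    simp only [Pi.smul_apply, gradient]
    rw [fderiv_const_smul (hφ.smooth.differentiable (by simp) x), map_smul]

/-- `H¹₀(Ω)` as a subspace of `H¹(Ω)`: the closure of `C_c^∞(Ω)`. -/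
def h10Submodule (Ω : Domain N) : Submodule ℝ (H1 Ω) := (testSubmodule Ω).topologicalClosure

/-- The space `H¹₀(Ω)`. Its norm, introduced below, is `‖∇f‖_{L²}`. -/
def H10 (Ω : Domain N) : Type := h10Submodule Ω

instance instAddCommGroupH10 (Ω : Domain N) : AddCommGroup (H10 Ω) :=
  inferInstanceAs (AddCommGroup (h10Submodule Ω))

instance instModuleH10 (Ω : Domain N) : Module ℝ (H10 Ω) :=
  inferInstanceAs (Module ℝ (h10Submodule Ω))

/-- The inclusion `H¹₀(Ω) ⊆ H¹(Ω)`. -/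
def H10.toH1 (Ω : Domain N) : H10 Ω →ₗ[ℝ] H1 Ω := (h10Submodule Ω).subtype

/-- The function underlying an element of `H¹₀(Ω)`. -/
def H10.val {Ω : Domain N} (f : H10 Ω) : L2 Ω ℝ := (H10.toH1 Ω f).val

/-- The weak gradient on `H¹₀(Ω)`. -/
def H10.gradₗ (Ω : Domain N) : H10 Ω →ₗ[ℝ] L2 Ω (Sp N) where
  toFun f := (H10.toH1 Ω f).grad
  map_add' _ _ := rfl
  map_smul' _ _ := rfl

theorem integral_sq_eq {Ω : Domain N} {V : Type} [NormedAddCommGroup V]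
    [InnerProductSpace ℝ V] (f : L2 Ω V) :
    ‖f‖ ^ 2 = ∫ x, ‖f x‖ ^ 2 ∂Ω.vol := by
  rw [← real_inner_self_eq_norm_sq, L2.inner_def]
  simp

/-- Integration by parts of `φ²` against the `i`-th coordinate. -/
theorem integral_sq_parts {φ : Sp N → ℝ} (hs : ContDiff ℝ ∞ φ) (hc : HasCompactSupport φ)
    (i : Fin N) :
    Integrable (fun x => x i * (2 * φ x * fderiv ℝ φ x (EuclideanSpace.single i 1))) ∧
    ∫ x, φ x ^ 2 = -∫ x, x i * (2 * φ x * fderiv ℝ φ x (EuclideanSpace.single i 1)) := by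
  have hφd : Differentiable ℝ φ := hs.differentiable (by simp)
  have hcφ : Continuous φ := hs.continuous
  have hcd : Continuous (fun x => fderiv ℝ φ x (EuclideanSpace.single i 1)) :=
    (hs.continuous_fderiv (by simp)).clm_apply continuous_const
  have hci : Continuous (fun x : Sp N => x i) :=
    (EuclideanSpace.proj (𝕜 := ℝ) i : Sp N →L[ℝ] ℝ).continuous
  have hs2 : HasCompactSupport (fun x => φ x ^ 2) :=
    hc.comp_left (g := fun t : ℝ => t ^ 2) (by simp)
  have hsq : ∀ x, fderiv ℝ (fun y => φ y ^ 2) x (EuclideanSpace.single i 1)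
      = 2 * φ x * fderiv ℝ φ x (EuclideanSpace.single i 1) := by
    intro x
    have := ((hφd x).hasFDerivAt.pow 2).fderiv
    rw [this]; simp [mul_assoc]
  have hco : ∀ x, fderiv ℝ (fun y : Sp N => y i) x (EuclideanSpace.single i 1) = 1 := by
    intro x
    have h2 : fderiv ℝ (fun y : Sp N => y i) x
      = (EuclideanSpace.proj (𝕜 := ℝ) i : Sp N →L[ℝ] ℝ) :=
        (EuclideanSpace.proj (𝕜 := ℝ) i : Sp N →L[ℝ] ℝ).fderiv
    rw [h2]; simp
  have hint : Integrable
      (fun x => x i * (2 * φ x * fderiv ℝ φ x (EuclideanSpace.single i 1))) := by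
    refine (hci.mul ((continuous_const.mul hcφ).mul hcd)).integrable_of_hasCompactSupport ?_
    refine hc.mono' fun x hx => subset_tsupport _ fun h => hx ?_
    simp [h]
  refine ⟨hint, ?_⟩
  have key := integral_mul_fderiv_eq_neg_fderiv_mul_of_integrable (𝕜 := ℝ)
    (μ := (volume : Measure (Sp N))) (f := fun y : Sp N => y i) (g := fun y => φ y ^ 2)
    (v := EuclideanSpace.single i 1)
    (by
      simp only [hco, one_mul]
      exact (hcφ.pow 2).integrable_of_hasCompactSupport hs2)
    (by simp only [hsq]; exact hint)
    ((hci.mul (hcφ.pow 2)).integrable_of_hasCompactSupport hs2.mul_left)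
    (fun x _ => (EuclideanSpace.proj (𝕜 := ℝ) i : Sp N →L[ℝ] ℝ).differentiableAt)
    (fun x _ => (hφd x).pow 2)
  simp only [hsq, hco, one_mul] at key
  rw [key, neg_neg]

theorem abs_fderiv_single_le (φ : Sp N → ℝ) (i : Fin N) (x : Sp N) :
    |fderiv ℝ φ x (EuclideanSpace.single i 1)| ≤ ‖∇ φ x‖ := by
  have h1 := (fderiv ℝ φ x).le_opNorm (EuclideanSpace.single i 1)
  simpa [gradient] using h1

theorem continuous_gradient_of_smooth {φ : Sp N → ℝ} (hs : ContDiff ℝ ∞ φ) :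
    Continuous (∇ φ) :=
  (InnerProductSpace.toDual ℝ (Sp N)).symm.continuous.comp (hs.continuous_fderiv (by simp))

/-- Poincaré's inequality for smooth compactly supported functions on a bounded set. -/
theorem integral_sq_le (Ω : Domain N) :
    ∃ C : ℝ, 0 ≤ C ∧ ∀ φ, IsTest Ω φ →
      ∫ x in Ω.carrier, ‖φ x‖ ^ 2 ≤ C ^ 2 * ∫ x in Ω.carrier, ‖∇ φ x‖ ^ 2 := by
  obtain ⟨R, hR0, hR⟩ := Ω.isBounded.exists_pos_norm_le
  have hN : 0 < N := by rcases Ω.dim with h | h <;> omega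
  obtain ⟨i⟩ : Nonempty (Fin N) := ⟨⟨0, hN⟩⟩
  refine ⟨2 * R, by positivity, fun φ hφ => ?_⟩
  obtain ⟨hint, hparts⟩ := integral_sq_parts hφ.smooth hφ.compact i
  have hcφ : Continuous φ := hφ.smooth.continuous
  have hsupp : ∀ x, x ∉ Ω.carrier → φ x = 0 := fun x hx =>
    image_eq_zero_of_notMem_tsupport fun h => hx (hφ.support h)
  have hgz : ∀ x, x ∉ tsupport φ → ∇ φ x = 0 := fun x hx => by
    simp [gradient, fderiv_of_notMem_tsupport (𝕜 := ℝ) hx]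
  have hgc : Continuous (∇ φ) := continuous_gradient_of_smooth hφ.smooth
  have hc1 : Continuous (fun x => φ x ^ 2) := hcφ.pow 2
  have hs1 : HasCompactSupport (fun x => φ x ^ 2) :=
    hφ.compact.mono' fun x hx => subset_tsupport _ fun h => hx (by simp [h])
  have hI1 : Integrable (fun x => φ x ^ 2) := hc1.integrable_of_hasCompactSupport hs1
  have hc2 : Continuous (fun x => ‖∇ φ x‖ ^ 2) := hgc.norm.pow 2
  have hs2 : HasCompactSupport (fun x => ‖∇ φ x‖ ^ 2) := by
    refine hφ.compact.mono' fun x hx => ?_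
    by_contra h
    exact hx (by simp [hgz x h])
  have hI2 : Integrable (fun x => ‖∇ φ x‖ ^ 2) := hc2.integrable_of_hasCompactSupport hs2
  have hpt : ∀ x, -(x i * (2 * φ x * fderiv ℝ φ x (EuclideanSpace.single i 1)))
      ≤ 1 / 2 * φ x ^ 2 + 2 * R ^ 2 * ‖∇ φ x‖ ^ 2 := by
    intro x
    by_cases hx : x ∈ Ω.carrier
    · have h1 : |x i| ≤ R := (PiLp.norm_apply_le x i).trans (hR x hx)
      have h2 := abs_fderiv_single_le φ i x
      refine (neg_le_abs _).trans ?_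
      rw [abs_mul, abs_mul, abs_mul, abs_two, ← sq_abs (φ x)]
      have h3 : |x i| * (2 * |φ x| * |fderiv ℝ φ x (EuclideanSpace.single i 1)|)
          ≤ R * (2 * |φ x| * ‖∇ φ x‖) := by gcongr
      refine h3.trans ?_
      generalize |φ x| = a
      generalize ‖∇ φ x‖ = b
      linarith [sq_nonneg (a - 2 * R * b)]
    · rw [hsupp x hx]
      simp only [mul_zero, zero_mul, neg_zero]
      positivity
  have hbound : ∫ x, φ x ^ 2 ≤ 1 / 2 * (∫ x, φ x ^ 2) + 2 * R ^ 2 * ∫ x, ‖∇ φ x‖ ^ 2 := by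
    rw [← integral_const_mul, ← integral_const_mul,
      ← integral_add (hI1.const_mul _) (hI2.const_mul _)]
    conv_lhs => rw [hparts, ← integral_neg]
    exact integral_mono hint.neg ((hI1.const_mul _).add (hI2.const_mul _)) hpt
  rw [setIntegral_eq_integral_of_forall_compl_eq_zero (fun x hx => by simp [hsupp x hx]),
    setIntegral_eq_integral_of_forall_compl_eq_zero
      (fun x hx => by simp [hgz x fun h => hx (hφ.support h)])]
  simp only [Real.norm_eq_abs, sq_abs]
  generalize (∫ x, φ x ^ 2) = a at hbound ⊢
  generalize (∫ x, ‖∇ φ x‖ ^ 2) = b at hbound ⊢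
  linarith

/-- Poincaré's inequality on `H¹₀(Ω)`. -/
theorem poincare (Ω : Domain N) :
    ∃ C : ℝ, ∀ f ∈ h10Submodule Ω, ‖f.val‖ ≤ C * ‖f.grad‖ := by
  obtain ⟨C, hC, h⟩ := integral_sq_le Ω
  refine ⟨C, fun f hf => ?_⟩
  have hcl : IsClosed {f : H1 Ω | ‖f.val‖ ≤ C * ‖f.grad‖} := by
    refine isClosed_le ?_ ?_
    · exact ((WithLp.fstL 2 ℝ _ _).continuous.comp continuous_subtype_val).norm
    · exact continuous_const.mul
        ((WithLp.sndL 2 ℝ _ _).continuous.comp continuous_subtype_val).norm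
  refine closure_minimal ?_ hcl hf
  rintro g ⟨φ, hφ, hf, hg⟩
  change ‖g.val‖ ≤ C * ‖g.grad‖
  refine le_of_sq_le_sq ?_ (by positivity)
  rw [mul_pow, integral_sq_eq, integral_sq_eq]
  rw [integral_congr_ae (g := fun x => ‖φ x‖ ^ 2) (by filter_upwards [hf] with x hx; rw [hx]),
    integral_congr_ae (f := fun x => ‖g.grad x‖ ^ 2) (g := fun x => ‖∇ φ x‖ ^ 2)
      (by filter_upwards [hg] with x hx; rw [hx])]
  exact h φ hφ

theorem H10.gradₗ_injective (Ω : Domain N) : Function.Injective (H10.gradₗ Ω) := by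
  refine (injective_iff_map_eq_zero _).2 fun f hf => ?_
  obtain ⟨C, h⟩ := poincare Ω
  have h1 := h f.1 f.2
  have h2 : (f.1 : H1 Ω).grad = 0 := hf
  rw [h2, norm_zero, mul_zero] at h1
  have h3 : (f.1 : H1 Ω).val = 0 := norm_le_zero_iff.1 h1
  refine Subtype.ext (Subtype.ext ?_)
  exact (WithLp.ofLp_injective 2) (Prod.ext h3 h2)

/-- The norm `‖f‖ = ‖∇f‖_{L²}` on `H¹₀(Ω)`. -/
instance instNormedAddCommGroupH10 (Ω : Domain N) : NormedAddCommGroup (H10 Ω) :=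
  NormedAddCommGroup.induced (H10 Ω) (L2 Ω (Sp N)) (H10.gradₗ Ω) (H10.gradₗ_injective Ω)

instance instNormedSpaceH10 (Ω : Domain N) : NormedSpace ℝ (H10 Ω) :=
  NormedSpace.induced ℝ (H10 Ω) (L2 Ω (Sp N)) (H10.gradₗ Ω)

/-- The weak gradient as a linear isometry `H¹₀(Ω) → L²(Ω; ℝ^N)`. -/
def H10.gradIsometry (Ω : Domain N) : H10 Ω →ₗᵢ[ℝ] L2 Ω (Sp N) where
  toLinearMap := H10.gradₗ Ω
  norm_map' _ := rfl

/-- The weak gradient of an element of `H¹₀(Ω)`. -/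
def H10.grad {Ω : Domain N} (f : H10 Ω) : L2 Ω (Sp N) := H10.gradIsometry Ω f

/-- `H⁻¹(Ω)`, the dual of `H¹₀(Ω)` with the dual norm. -/
abbrev HNeg1 (Ω : Domain N) : Type := H10 Ω →L[ℝ] ℝ

instance instNormedAddCommGroupHNeg1 (Ω : Domain N) : NormedAddCommGroup (HNeg1 Ω) :=
  inferInstance

set_option synthInstance.maxHeartbeats 200000 in
instance instNormedSpaceHNeg1 (Ω : Domain N) : NormedSpace ℝ (HNeg1 Ω) :=
  inferInstance

/-- `H²(Ω) ∩ H¹₀(Ω)` as a subspace of `H²(Ω)`. -/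
def h20Submodule (Ω : Domain N) : Submodule ℝ (H2 Ω) :=
  (h10Submodule Ω).comap (H2.toH1 Ω).toLinearMap

/-- The space `H²(Ω) ∩ H¹₀(Ω)` with the norm of `H²(Ω)`. -/
abbrev H20 (Ω : Domain N) : Type := h20Submodule Ω

instance instNormedAddCommGroupH20 (Ω : Domain N) : NormedAddCommGroup (H20 Ω) :=
  inferInstance

set_option synthInstance.maxHeartbeats 200000 in
instance instNormedSpaceH20 (Ω : Domain N) : NormedSpace ℝ (H20 Ω) :=
  inferInstance

/-- `-∇·V ∈ H⁻¹(Ω)` for a vector field `V` on `Ω` of class `L²`: the functional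
`φ ↦ ∫_Ω V·∇φ`. (Zero by convention if `V` is not of class `L²`.) -/
def negDiv (Ω : Domain N) (V : Sp N → Sp N) : HNeg1 Ω :=
  open Classical in
  if hV : MemLp V 2 Ω.vol then
    (innerSL ℝ (hV.toLp V)).comp (H10.gradIsometry Ω).toContinuousLinearMap
  else 0

theorem negDiv_apply {Ω : Domain N} {V : Sp N → Sp N} (hV : MemLp V 2 Ω.vol) (φ : H10 Ω) :
    negDiv Ω V φ = ∫ x in Ω.carrier, ⟪V x, φ.grad x⟫_ℝ := by
  rw [negDiv, dif_pos hV]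
  change ⟪hV.toLp V, φ.grad⟫_ℝ = _
  rw [L2.inner_def]
  refine integral_congr_ae ?_
  filter_upwards [hV.coeFn_toLp] with x hx
  rw [hx]

/-! ### The drift-diffusion map -/

/-- The data of the steady drift-diffusion system on `Ω`: diffusion and drift coefficients,
permanent charge `D ∈ L^∞(Ω)`, and functions `(a_u, a_n, a_p) ∈ H² × H¹ × H¹` carrying the
Dirichlet data. -/
structure Data (Ω : Domain N) where
  dn : ℝ
  cn : ℝ
  dp : ℝ
  cp : ℝ
  dn_pos : 0 < dn
  cn_pos : 0 < cn
  dp_pos : 0 < dp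
  cp_pos : 0 < cp
  /-- The permanent charge. -/
  D : Lp ℝ ∞ Ω.vol
  au : H2 Ω
  an : H1 Ω
  ap : H1 Ω

/-- `𝓗 = (H² ∩ H¹₀) × H¹₀ × H¹₀`, with elements `h = (ρ, σ, τ)`. -/
abbrev HSpace (Ω : Domain N) : Type := H20 Ω × H10 Ω × H10 Ω

instance instNormedAddCommGroupHSpace (Ω : Domain N) : NormedAddCommGroup (HSpace Ω) :=
  inferInstance

set_option synthInstance.maxHeartbeats 200000 in
instance instNormedSpaceHSpace (Ω : Domain N) : NormedSpace ℝ (HSpace Ω) :=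
  inferInstance

/-- `𝓖 = L² × H⁻¹ × H⁻¹`. -/
abbrev GSpace (Ω : Domain N) : Type := L2 Ω ℝ × HNeg1 Ω × HNeg1 Ω

instance instNormedAddCommGroupGSpace (Ω : Domain N) : NormedAddCommGroup (GSpace Ω) :=
  inferInstance

set_option synthInstance.maxHeartbeats 200000 in
instance instNormedSpaceGSpace (Ω : Domain N) : NormedSpace ℝ (GSpace Ω) :=
  inferInstance

namespace Data

variable {Ω : Domain N} (P : Data Ω)

/-- `D` as an element of `L²(Ω)`. -/
def D2 : L2 Ω ℝ := ((Lp.memLp P.D).mono_exponent le_top).toLp P.D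

/-- `u = ρ + a_u`. -/
def u (h : HSpace Ω) : H2 Ω := (h.1 : H2 Ω) + P.au

/-- `n = σ + a_n`. -/
def n (h : HSpace Ω) : H1 Ω := H10.toH1 Ω h.2.1 + P.an

/-- `p = τ + a_p`. -/
def p (h : HSpace Ω) : H1 Ω := H10.toH1 Ω h.2.2 + P.ap

/-- The field `d_n ∇n - c_n n ∇u`. -/
def fluxN (h : HSpace Ω) (x : Sp N) : Sp N :=
  P.dn • (P.n h).grad x - (P.cn * (P.n h).val x) • (P.u h).grad x

/-- The field `d_p ∇p + c_p p ∇u`. -/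
def fluxP (h : HSpace Ω) (x : Sp N) : Sp N :=
  P.dp • (P.p h).grad x + (P.cp * (P.p h).val x) • (P.u h).grad x

/-- The drift-diffusion map `F : 𝓗 × [0,1] → 𝓖`:
`F₁ = -∇²u + λ(n - p) - D`, `F₂ = -∇·(d_n ∇n - c_n n ∇u)`, `F₃ = -∇·(d_p ∇p + c_p p ∇u)`. -/
def F (h : HSpace Ω) (lam : unitInterval) : GSpace Ω :=
  (-(P.u h).laplacian + (lam : ℝ) • ((P.n h).val - (P.p h).val) - P.D2,
    negDiv Ω (P.fluxN h), negDiv Ω (P.fluxP h))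

/-- The linearised field `d_n ∇σ' - c_n σ' ∇u - c_n n ∇ρ'` at `h`, in the direction
`h' = (ρ', σ', τ')`. -/
def fluxN' (h h' : HSpace Ω) (x : Sp N) : Sp N :=
  P.dn • h'.2.1.grad x - (P.cn * h'.2.1.val x) • (P.u h).grad x
    - (P.cn * (P.n h).val x) • (h'.1 : H2 Ω).grad x

/-- The linearised field `d_p ∇τ' + c_p τ' ∇u + c_p p ∇ρ'` at `h`, in the direction
`h' = (ρ', σ', τ')`. -/
def fluxP' (h h' : HSpace Ω) (x : Sp N) : Sp N :=
  P.dp • h'.2.2.grad x + (P.cp * h'.2.2.val x) • (P.u h).grad x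
    + (P.cp * (P.p h).val x) • (h'.1 : H2 Ω).grad x

/-- The partial Fréchet derivative `F_h(h, λ) : 𝓗 → 𝓖`. -/
def Fh (h : HSpace Ω) (lam : unitInterval) : HSpace Ω →L[ℝ] GSpace Ω :=
  fderiv ℝ (fun k => P.F k lam) h

end Data

end DriftDiffusion

end

noncomputable section

namespace DriftDiffusion

/-! ### Sobolev embedding on convex sets -/

/-! `F` is polynomial. `F₁` is affine in `h`, with `λ` multiplying a bounded affine term; `F₂` and
`F₃` add to a bounded affine part the quadratic product `n ∇u` or `p ∇u`. Everything therefore rests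
on one estimate: `(n, w) ↦ n ∇w` is bounded and bilinear from `H¹ × H²` to `L²`
(`exists_norm_mulGradₗ_le`). Given this, the product rule yields the derivative, which is affine in
`h` for fixed `λ` and visibly continuous in `(h, λ)`. Poincaré's inequality makes the gradient norm
of `H¹₀` control the `H¹` norm, so that the components of `h` depend boundedly on `h`.

By Hölder with `1/4 + 1/4 = 1/2`, the estimate follows from the embedding `H¹ ⊆ L⁴`
(`exists_lintegral_pow_four_le`), applied to `n` and to each component of `∇w`. Convexity permits a
direct proof. For `f` of class `C¹` on a convex set `K` of diameter at most `d`, the fundamental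
theorem of calculus on segments, integrated over the endpoint `y`, gives `|K| |f(x)| ≤ ∫_K |f| + d
∫₀¹ ∫_K |∇f(x + t(y - x))| dy dt`. For fixed `t` the inner integral maps `L²` to `L⁴` with norm at
most a constant times `t^(-3/4)`, because `N ≤ 3`; this is integrable on `(0,1)`
(`lintegral_pow_four_segment_average_le`).

A weakly differentiable `f` is mollified. On the points of `Ω` whose closed `r`-ball stays inside
`Ω`, again a convex set, the gradient of the mollification is the mollified weak gradient, whose
`L²` norm is no larger. The constants depend only on volume and diameter, so Fatou's lemma passes to
the limit `r → 0`; neither an extension operator nor a trace is needed. -/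

/-- Jensen's inequality for the square. -/
theorem sq_lintegral_le {α : Type*} [MeasurableSpace α] (μ : Measure α) {g : α → ℝ≥0∞}
    (hg : AEMeasurable g μ) : (∫⁻ x, g x ∂μ) ^ 2 ≤ μ univ * ∫⁻ x, g x ^ 2 ∂μ := by
  have h := ENNReal.lintegral_mul_le_Lp_mul_Lq μ Real.HolderConjugate.two_two
    (f := fun _ => 1) aemeasurable_const hg
  have h2 := pow_le_pow_left' h 2
  simp only [Pi.mul_apply, one_mul, ENNReal.one_rpow, lintegral_one, mul_pow] at h2
  simp only [← ENNReal.rpow_natCast, ← ENNReal.rpow_mul] at h2 ⊢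
  simpa using h2

theorem pow_four_lintegral_le {α : Type*} [MeasurableSpace α] (μ : Measure α) {g : α → ℝ≥0∞}
    (hg : AEMeasurable g μ) : (∫⁻ x, g x ∂μ) ^ 4 ≤ μ univ ^ 3 * ∫⁻ x, g x ^ 4 ∂μ := by
  calc (∫⁻ x, g x ∂μ) ^ 4 = ((∫⁻ x, g x ∂μ) ^ 2) ^ 2 := by rw [← pow_mul]
    _ ≤ (μ univ * ∫⁻ x, g x ^ 2 ∂μ) ^ 2 := by gcongr; exact sq_lintegral_le μ hg
    _ = μ univ ^ 2 * (∫⁻ x, g x ^ 2 ∂μ) ^ 2 := by rw [mul_pow]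
    _ ≤ μ univ ^ 2 * (μ univ * ∫⁻ x, (g x ^ 2) ^ 2 ∂μ) := by
        gcongr; exact sq_lintegral_le μ (hg.pow_const 2)
    _ = _ := by simp only [← pow_mul]; rw [← mul_assoc, ← pow_succ]

theorem lintegral_Ioo_rpow {r : ℝ} (hr : -1 < r) :
    ∫⁻ t in Ioo (0 : ℝ) 1, ENNReal.ofReal (t ^ r) = ENNReal.ofReal (r + 1)⁻¹ := by
  have hi : IntervalIntegrable (fun t : ℝ => t ^ r) volume 0 1 :=
    intervalIntegral.intervalIntegrable_rpow' hr
  rw [← ofReal_integral_eq_lintegral_ofReal]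
  · rw [← integral_Ioc_eq_integral_Ioo, ← intervalIntegral.integral_of_le zero_le_one,
      integral_rpow (Or.inl hr), Real.one_rpow, Real.zero_rpow (by linarith), sub_zero, one_div]
  · exact ((intervalIntegrable_iff_integrableOn_Ioo_of_le zero_le_one).1 hi)
  · filter_upwards [ae_restrict_mem measurableSet_Ioo] with t ht
    exact Real.rpow_nonneg ht.1.le r

/-- Hölder's inequality on `(0,1)` with a power weight. -/
theorem pow_four_lintegral_Ioo_le {g : ℝ → ℝ≥0∞} (hg : Measurable g) :
    (∫⁻ t in Ioo (0 : ℝ) 1, g t) ^ 4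
      ≤ 216 * ∫⁻ t in Ioo (0 : ℝ) 1, ENNReal.ofReal (t ^ (5 / 2 : ℝ)) * g t ^ 4 := by
  have hm : ∀ r : ℝ, Measurable (fun t : ℝ => ENNReal.ofReal (t ^ r)) := fun r => by fun_prop
  -- The weight `t^(-5/6)` has mass 6 on `(0,1)`, whence `216 = 6 ^ 3`. The resulting exponent is
  -- `-5/6 + 4 · 5/6 = 5/2`, large enough that `t^(5/2) t^(-3) = t^(-1/2)` is still integrable at 0.
  have h := pow_four_lintegral_le
    ((volume.restrict (Ioo (0 : ℝ) 1)).withDensity fun t => ENNReal.ofReal (t ^ (-(5 / 6) : ℝ)))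
    (g := fun t => ENNReal.ofReal (t ^ (5 / 6 : ℝ)) * g t) ((hm _).mul hg).aemeasurable
  rw [lintegral_withDensity_eq_lintegral_mul _ (hm _)
      (g := fun t => ENNReal.ofReal (t ^ (5 / 6 : ℝ)) * g t) ((hm _).mul hg),
    lintegral_withDensity_eq_lintegral_mul _ (hm _)
      (g := fun t => (ENNReal.ofReal (t ^ (5 / 6 : ℝ)) * g t) ^ 4)
      (((hm _).mul hg).pow_const 4),
    withDensity_apply _ MeasurableSet.univ, Measure.restrict_univ,
    lintegral_Ioo_rpow (by norm_num)] at h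
  refine le_trans (le_of_eq ?_) (h.trans (le_of_eq ?_))
  · congr 1
    refine setLIntegral_congr_fun measurableSet_Ioo fun t ht => ?_
    simp only [Pi.mul_apply]
    rw [← mul_assoc, ← ENNReal.ofReal_mul (Real.rpow_nonneg ht.1.le _), ← Real.rpow_add ht.1]
    norm_num
  · congr 1
    · rw [← ENNReal.ofReal_pow (by norm_num)]; norm_num
    · refine setLIntegral_congr_fun measurableSet_Ioo fun t ht => ?_
      simp only [Pi.mul_apply]
      rw [mul_pow, ← mul_assoc, ← ENNReal.ofReal_pow (Real.rpow_nonneg ht.1.le _),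
        ← ENNReal.ofReal_mul (Real.rpow_nonneg ht.1.le _), ← Real.rpow_mul_natCast ht.1.le,
        ← Real.rpow_add ht.1]
      norm_num

variable {N : ℕ}

theorem lintegral_comp_add_smul {f : Sp N → ℝ≥0∞} (hf : Measurable f) (a : Sp N) {s : ℝ}
    (hs : 0 < s) :
    ∫⁻ z, f (a + s • z) = ENNReal.ofReal (s ^ N)⁻¹ * ∫⁻ z, f z := by
  have h := Measure.map_addHaar_smul (volume : Measure (Sp N)) hs.ne'
  have h1 : ∫⁻ z, f (a + z) ∂(Measure.map (s • ·) (volume : Measure (Sp N)))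
      = ∫⁻ z, f (a + s • z) :=
    lintegral_map (hf.comp (measurable_const_add a)) (measurable_const_smul s)
  rw [← h1, h, lintegral_smul_measure, lintegral_add_left_eq_self f a, smul_eq_mul,
    finrank_euclideanSpace_fin, abs_of_pos (by positivity)]

/-- The bound is uniform in `t` because the substitution is made in whichever endpoint carries
weight at least 1/2: in `y` if `t ≥ 1/2`, in `x` otherwise. The Jacobian factor is then at most `2 ^
N ≤ 8`. -/
theorem lintegral_lintegral_segment_le (hN : N ≤ 3) (K : Set (Sp N)) {g : Sp N → ℝ≥0∞}
    (hg : Measurable g) {t : ℝ} (ht : t ∈ Ioo (0 : ℝ) 1) :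
    ∫⁻ x in K, ∫⁻ y in K, g (x + t • (y - x)) ≤ volume K * (8 * ∫⁻ z, g z) := by
  have hinv : ∀ s : ℝ, 1 / 2 ≤ s → s ≤ 1 → ENNReal.ofReal (s ^ N)⁻¹ ≤ 8 := by
    intro s h1 h2
    have h0 : (1 / 8 : ℝ) ≤ s ^ N := calc
      (1 / 8 : ℝ) = (1 / 2) ^ 3 := by norm_num
      _ ≤ s ^ 3 := by gcongr
      _ ≤ s ^ N := pow_le_pow_of_le_one (by linarith) h2 hN
    refine ENNReal.ofReal_le_of_le_toReal ?_
    simpa using inv_anti₀ (by norm_num) h0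
  have hconst : ∀ c : ℝ≥0∞, ∫⁻ _ in K, c = volume K * c := fun c => by
    rw [setLIntegral_const, mul_comm]
  rw [← hconst]
  rcases le_total (1 / 2) t with h | h
  · refine lintegral_mono fun x => ?_
    calc ∫⁻ y in K, g (x + t • (y - x)) ≤ ∫⁻ y, g (x + t • (y - x)) :=
          setLIntegral_le_lintegral _ _
      _ = ∫⁻ y, g ((x - t • x) + t • y) := by
          congr 1; ext y; congr 1; rw [smul_sub]; abel
      _ = _ := lintegral_comp_add_smul hg _ ht.1
      _ ≤ _ := by gcongr; exact hinv t h ht.2.le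
  · rw [lintegral_lintegral_swap (by fun_prop)]
    refine lintegral_mono fun y => ?_
    calc ∫⁻ x in K, g (x + t • (y - x)) ≤ ∫⁻ x, g (x + t • (y - x)) :=
          setLIntegral_le_lintegral _ _
      _ = ∫⁻ x, g (t • y + (1 - t) • x) := by
          congr 1; ext y; congr 1; rw [smul_sub, sub_smul, one_smul]; abel
      _ = _ := lintegral_comp_add_smul hg _ (by linarith [ht.2])
      _ ≤ _ := by gcongr; exact hinv _ (by linarith) (by linarith [ht.1])

/-- Cauchy–Schwarz bounds the square of the inner integral by `|K| ∫_K g²` along the segments, so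
the fourth power is a product of two such factors. One is estimated pointwise in `x`, at the cost of
`t^(-N) ≤ t^(-3)`; the other is integrated in `x`, with a constant free of `t`. The singularity is
thus paid for only once. -/
theorem lintegral_pow_four_segment_le (hN : N ≤ 3) (K : Set (Sp N)) {g : Sp N → ℝ≥0∞}
    (hg : Measurable g) {t : ℝ} (ht : t ∈ Ioo (0 : ℝ) 1) :
    ∫⁻ x in K, (∫⁻ y in K, g (x + t • (y - x))) ^ 4
      ≤ ENNReal.ofReal (t ^ (-3 : ℝ)) * (8 * volume K ^ 3 * (∫⁻ z, g z ^ 2) ^ 2) := by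
  have ha : ∀ x : Sp N, (∫⁻ y in K, g (x + t • (y - x))) ^ 2
      ≤ volume K * ∫⁻ y in K, g (x + t • (y - x)) ^ 2 := fun x => by
    simpa using sq_lintegral_le (volume.restrict K) (g := fun y => g (x + t • (y - x)))
      (by fun_prop)
  have hb : ∀ x : Sp N, ∫⁻ y in K, g (x + t • (y - x)) ^ 2
      ≤ ENNReal.ofReal (t ^ (-3 : ℝ)) * ∫⁻ z, g z ^ 2 := fun x => by
    calc ∫⁻ y in K, g (x + t • (y - x)) ^ 2 ≤ ∫⁻ y, g (x + t • (y - x)) ^ 2 :=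
          setLIntegral_le_lintegral _ _
      _ = ∫⁻ y, g ((x - t • x) + t • y) ^ 2 := by
          congr 1; ext y; congr 2; rw [smul_sub]; abel
      _ = _ := lintegral_comp_add_smul (hg.pow_const 2) _ ht.1
      _ ≤ _ := by
        gcongr
        rw [Real.rpow_neg ht.1.le]
        refine inv_anti₀ (Real.rpow_pos_of_pos ht.1 _) ?_
        rw [show (3 : ℝ) = ((3 : ℕ) : ℝ) by norm_num, Real.rpow_natCast]
        exact pow_le_pow_of_le_one ht.1.le ht.2.le hN
  set S := ∫⁻ z, g z ^ 2
  set c := ENNReal.ofReal (t ^ (-3 : ℝ))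
  calc ∫⁻ x in K, (∫⁻ y in K, g (x + t • (y - x))) ^ 4
      ≤ ∫⁻ x in K, (volume K ^ 2 * (c * S)) * ∫⁻ y in K, g (x + t • (y - x)) ^ 2 := by
        refine lintegral_mono fun x => ?_
        calc (∫⁻ y in K, g (x + t • (y - x))) ^ 4
            = ((∫⁻ y in K, g (x + t • (y - x))) ^ 2) ^ 2 := by rw [← pow_mul]
          _ ≤ (volume K * ∫⁻ y in K, g (x + t • (y - x)) ^ 2) ^ 2 := by gcongr; exact ha x
          _ = volume K ^ 2 * (∫⁻ y in K, g (x + t • (y - x)) ^ 2)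
                * ∫⁻ y in K, g (x + t • (y - x)) ^ 2 := by ring
          _ ≤ _ := by gcongr; exact hb x
    _ = (volume K ^ 2 * (c * S)) * ∫⁻ x in K, ∫⁻ y in K, g (x + t • (y - x)) ^ 2 := by
        refine lintegral_const_mul _ ?_
        exact Measurable.lintegral_prod_right'
          (f := fun z : Sp N × Sp N => g (z.1 + t • (z.2 - z.1)) ^ 2) (by fun_prop)
    _ ≤ (volume K ^ 2 * (c * S)) * (volume K * (8 * S)) := by
        gcongr
        exact lintegral_lintegral_segment_le hN K (hg.pow_const 2) ht
    _ = _ := by ring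

/-- In dimension at most three, averaging over the segments that join points of `K` maps
`L²` to `L⁴`. -/
theorem lintegral_pow_four_segment_average_le (hN : N ≤ 3) (K : Set (Sp N)) {g : Sp N → ℝ≥0∞}
    (hg : Measurable g) :
    ∫⁻ x in K, (∫⁻ t in Ioo (0 : ℝ) 1, ∫⁻ y in K, g (x + t • (y - x))) ^ 4
      ≤ 3456 * volume K ^ 3 * (∫⁻ z, g z ^ 2) ^ 2 := by
  have hG : Measurable (fun q : Sp N × ℝ => ∫⁻ y in K, g (q.1 + q.2 • (y - q.1))) :=
    Measurable.lintegral_prod_right'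
      (f := fun z : (Sp N × ℝ) × Sp N => g (z.1.1 + z.1.2 • (z.2 - z.1.1))) (by fun_prop)
  calc ∫⁻ x in K, (∫⁻ t in Ioo (0 : ℝ) 1, ∫⁻ y in K, g (x + t • (y - x))) ^ 4
      ≤ ∫⁻ x in K, 216 * ∫⁻ t in Ioo (0 : ℝ) 1, ENNReal.ofReal (t ^ (5 / 2 : ℝ))
          * (∫⁻ y in K, g (x + t • (y - x))) ^ 4 :=
        lintegral_mono fun x => pow_four_lintegral_Ioo_le (hG.comp measurable_prodMk_left)
    _ = 216 * ∫⁻ t in Ioo (0 : ℝ) 1, ENNReal.ofReal (t ^ (5 / 2 : ℝ))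
          * ∫⁻ x in K, (∫⁻ y in K, g (x + t • (y - x))) ^ 4 := by
        rw [lintegral_const_mul' _ _ (by simp), lintegral_lintegral_swap]
        · congr 1
          refine lintegral_congr fun t => ?_
          rw [lintegral_const_mul' _ _ (by simp)]
        · exact (Measurable.mul (by fun_prop) (hG.pow_const 4)).aemeasurable
    _ ≤ 216 * ∫⁻ t in Ioo (0 : ℝ) 1, ENNReal.ofReal (t ^ (-(1 / 2) : ℝ))
          * (8 * volume K ^ 3 * (∫⁻ z, g z ^ 2) ^ 2) := by
        gcongr 216 * ?_
        refine setLIntegral_mono' measurableSet_Ioo fun t ht => ?_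
        calc _ ≤ ENNReal.ofReal (t ^ (5 / 2 : ℝ)) * (ENNReal.ofReal (t ^ (-3 : ℝ))
              * (8 * volume K ^ 3 * (∫⁻ z, g z ^ 2) ^ 2)) := by
              gcongr; exact lintegral_pow_four_segment_le hN K hg ht
          _ = _ := by
            rw [← mul_assoc, ← ENNReal.ofReal_mul (Real.rpow_nonneg ht.1.le _),
              ← Real.rpow_add ht.1]
            norm_num
    _ = _ := by
        rw [lintegral_mul_const _ (by fun_prop), lintegral_Ioo_rpow (by norm_num)]
        -- The integral of `t^(-1/2)` over `(0,1)` is 2, and `216 · 2 · 8 = 3456`.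
        rw [show ENNReal.ofReal (-(1 / 2) + 1)⁻¹ = 2 by norm_num]
        ring

theorem enorm_le_add_lintegral_segment {f : Sp N → ℝ} (hf : ContDiff ℝ 1 f) {x y : Sp N}
    {d : ℝ≥0∞} (hd : ‖y - x‖ₑ ≤ d) :
    ‖f x‖ₑ ≤ ‖f y‖ₑ + d * ∫⁻ t in Ioo (0 : ℝ) 1, ‖fderiv ℝ f (x + t • (y - x))‖ₑ := by
  have hderiv : ∀ t : ℝ, HasDerivAt (fun t : ℝ => f (x + t • (y - x)))
      (fderiv ℝ f (x + t • (y - x)) (y - x)) t := by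
    intro t
    have h1 : HasDerivAt (fun t : ℝ => x + t • (y - x)) (y - x) t := by
      simpa using ((hasDerivAt_id t).smul_const (y - x)).const_add x
    exact ((hf.differentiable one_ne_zero _).hasFDerivAt).comp_hasDerivAt t h1
  have hcont : Continuous fun t : ℝ => fderiv ℝ f (x + t • (y - x)) (y - x) :=
    ((hf.continuous_fderiv one_ne_zero).comp (by fun_prop)).clm_apply continuous_const
  have hint := intervalIntegral.integral_eq_sub_of_hasDerivAt (a := 0) (b := 1)
    (fun t _ => hderiv t) (hcont.intervalIntegrable 0 1)
  simp only [one_smul, zero_smul, add_zero, add_sub_cancel] at hint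
  rw [intervalIntegral.integral_of_le zero_le_one, integral_Ioc_eq_integral_Ioo] at hint
  calc ‖f x‖ₑ = ‖f y - (f y - f x)‖ₑ := by rw [sub_sub_cancel]
    _ ≤ ‖f y‖ₑ + ‖f y - f x‖ₑ := enorm_sub_le
    _ ≤ _ := by
      gcongr
      rw [← hint]
      refine (enorm_integral_le_lintegral_enorm _).trans ?_
      rw [← lintegral_const_mul]
      · refine lintegral_mono fun t => ?_
        refine (ContinuousLinearMap.le_opENorm _ _).trans ?_
        rw [mul_comm]
        gcongr
      · exact ((hf.continuous_fderiv one_ne_zero).comp (by fun_prop)).enorm.measurable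

theorem add_pow_four_le (a b : ℝ≥0∞) : (a + b) ^ 4 ≤ 8 * (a ^ 4 + b ^ 4) := by
  have h := ENNReal.rpow_add_le_mul_rpow_add_rpow a b (p := 4) (by norm_num)
  have h2 : (2 : ℝ≥0∞) ^ ((4 : ℝ) - 1) = 8 := by
    rw [show (4 : ℝ) - 1 = ((3 : ℕ) : ℝ) by norm_num, ENNReal.rpow_natCast]; norm_num
  rw [h2] at h
  simpa only [show (4 : ℝ) = ((4 : ℕ) : ℝ) by norm_num, ENNReal.rpow_natCast] using h

/-- The `L⁴` Sobolev inequality for smooth functions on a convex set, with explicit constants. -/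
theorem lintegral_pow_four_le_of_contDiff (hN : N ≤ 3) {K : Set (Sp N)} (hK : MeasurableSet K)
    (hc : Convex ℝ K) {d : ℝ≥0∞} (hd : ∀ x ∈ K, ∀ y ∈ K, ‖y - x‖ₑ ≤ d) {f : Sp N → ℝ}
    (hf : ContDiff ℝ 1 f) :
    ∫⁻ x in K, (volume K * ‖f x‖ₑ) ^ 4
      ≤ 8 * (volume K ^ 3 * (∫⁻ x in K, ‖f x‖ₑ ^ 2) ^ 2
        + d ^ 4 * (3456 * volume K ^ 3 * (∫⁻ x in K, ‖fderiv ℝ f x‖ₑ ^ 2) ^ 2)) := by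
  -- The cut-off lets the averaging estimate on all of space see only the derivative on `K`. It
  -- loses nothing, since segments between points of `K` stay in `K`.
  set g : Sp N → ℝ≥0∞ := K.indicator fun x => ‖fderiv ℝ f x‖ₑ with hgdef
  have hfm : Measurable fun x => ‖f x‖ₑ := hf.continuous.enorm.measurable
  have hg : Measurable g :=
    ((hf.continuous_fderiv one_ne_zero).enorm.measurable).indicator hK
  have hg2 : ∫⁻ z, g z ^ 2 = ∫⁻ x in K, ‖fderiv ℝ f x‖ₑ ^ 2 := by
    rw [← lintegral_indicator hK]
    refine lintegral_congr fun x => ?_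
    by_cases hx : x ∈ K <;> simp [hgdef, hx]
  have hpt : ∀ x ∈ K, volume K * ‖f x‖ₑ ≤ (∫⁻ y in K, ‖f y‖ₑ)
      + d * ∫⁻ t in Ioo (0 : ℝ) 1, ∫⁻ y in K, g (x + t • (y - x)) := by
    -- Integrating the segment inequality over `y ∈ K` puts the factor `volume K` on the left;
    -- keeping it there avoids dividing by a volume that may vanish.
    intro x hx
    rw [lintegral_lintegral_swap (by fun_prop), mul_comm, ← setLIntegral_const]
    rw [← lintegral_const_mul, ← lintegral_add_left hfm]
    · refine setLIntegral_mono' hK fun y hy => ?_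
      refine (enorm_le_add_lintegral_segment hf (hd x hx y hy)).trans (le_of_eq ?_)
      congr 2
      refine setLIntegral_congr_fun measurableSet_Ioo fun t ht => ?_
      have : x + t • (y - x) ∈ K := hc.add_smul_sub_mem hx hy ⟨ht.1.le, ht.2.le⟩
      simp [hgdef, this]
    · exact Measurable.lintegral_prod_right'
        (f := fun z : Sp N × ℝ => g (x + z.2 • (z.1 - x))) (by fun_prop)
  have hf4 : (∫⁻ y in K, ‖f y‖ₑ) ^ 4 ≤ volume K ^ 2 * (∫⁻ x in K, ‖f x‖ₑ ^ 2) ^ 2 := by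
    have := sq_lintegral_le (volume.restrict K) hfm.aemeasurable
    rw [Measure.restrict_apply_univ] at this
    calc _ = ((∫⁻ y in K, ‖f y‖ₑ) ^ 2) ^ 2 := by rw [← pow_mul]
      _ ≤ (volume K * ∫⁻ x in K, ‖f x‖ₑ ^ 2) ^ 2 := by gcongr
      _ = _ := mul_pow _ _ _
  have hA : Measurable fun x : Sp N =>
      ∫⁻ t in Ioo (0 : ℝ) 1, ∫⁻ y in K, g (x + t • (y - x)) := by
    refine Measurable.lintegral_prod_right'
      (f := fun q : Sp N × ℝ => ∫⁻ y in K, g (q.1 + q.2 • (y - q.1))) ?_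
    exact Measurable.lintegral_prod_right'
      (f := fun z : (Sp N × ℝ) × Sp N => g (z.1.1 + z.1.2 • (z.2 - z.1.1))) (by fun_prop)
  calc ∫⁻ x in K, (volume K * ‖f x‖ₑ) ^ 4
      ≤ ∫⁻ x in K, 8 * ((volume K ^ 2 * (∫⁻ x in K, ‖f x‖ₑ ^ 2) ^ 2)
        + d ^ 4 * (∫⁻ t in Ioo (0 : ℝ) 1, ∫⁻ y in K, g (x + t • (y - x))) ^ 4) := by
        refine setLIntegral_mono' hK fun x hx => ?_
        refine (pow_le_pow_left' (hpt x hx) 4).trans ((add_pow_four_le _ _).trans ?_)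
        rw [mul_pow]
        gcongr
    _ = 8 * (volume K ^ 3 * (∫⁻ x in K, ‖f x‖ₑ ^ 2) ^ 2
        + d ^ 4 * ∫⁻ x in K,
          (∫⁻ t in Ioo (0 : ℝ) 1, ∫⁻ y in K, g (x + t • (y - x))) ^ 4) := by
        rw [lintegral_const_mul' _ _ (by simp), lintegral_add_left measurable_const,
          setLIntegral_const, lintegral_const_mul _ (hA.pow_const 4)]
        ring
    _ ≤ _ := by
        gcongr
        rw [← hg2]
        exact lintegral_pow_four_segment_average_le hN K hg

/-! ### Convex inner approximations of the domain -/

open Filter Topology ContinuousLinearMap Pointwise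

/-- The points of `Ω` at distance more than `r` from its complement. -/
def innerSet (Ω : Domain N) (r : ℝ) : Set (Sp N) := {x | Metric.closedBall x r ⊆ Ω.carrier}

theorem innerSet_subset (Ω : Domain N) {r : ℝ} (hr : 0 ≤ r) : innerSet Ω r ⊆ Ω.carrier :=
  fun _ hx => hx (Metric.mem_closedBall_self hr)

theorem innerSet_anti (Ω : Domain N) {r s : ℝ} (h : r ≤ s) : innerSet Ω s ⊆ innerSet Ω r :=
  fun _ hx => (Metric.closedBall_subset_closedBall h).trans hx

theorem isOpen_innerSet (Ω : Domain N) (r : ℝ) : IsOpen (innerSet Ω r) := by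
  -- A closed set plus a compact set is closed.
  have h : (innerSet Ω r)ᶜ = Ω.carrierᶜ + Metric.closedBall (0 : Sp N) r := by
    ext x
    simp only [innerSet, mem_compl_iff, mem_ofPred_eq, not_subset, Set.mem_add, Metric.mem_closedBall]
    constructor
    · rintro ⟨a, h1, h2⟩
      exact ⟨a, h2, x - a, by simpa [dist_eq_norm, norm_sub_rev] using h1, by abel⟩
    · rintro ⟨a, h1, b, h2, rfl⟩
      exact ⟨a, by simpa [dist_eq_norm] using h2, h1⟩
  rw [← isClosed_compl_iff, h]
  exact Ω.isOpen.isClosed_compl.add_right_of_isCompact (isCompact_closedBall _ _)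

theorem convex_innerSet (Ω : Domain N) (r : ℝ) : Convex ℝ (innerSet Ω r) := by
  intro x hx y hy a b ha hb hab z hz
  -- The same displacement is added to both endpoints; the convex combination of the displaced
  -- points, which lie in `Ω`, is `z`.
  have hw : ∀ p : Sp N, p + (z - (a • x + b • y)) ∈ Metric.closedBall p r := fun p => by
    simpa [dist_eq_norm] using hz
  have h := Ω.convex (hx (hw x)) (hy (hw y)) ha hb hab
  convert h using 1
  rw [smul_add, smul_add, add_add_add_comm, ← add_smul a b, hab, one_smul, add_sub_cancel]

theorem exists_mem_innerSet (Ω : Domain N) {x : Sp N} (hx : x ∈ Ω.carrier) :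
    ∃ r > 0, x ∈ innerSet Ω r :=
  Metric.nhds_basis_closedBall.mem_iff.1 (Ω.isOpen.mem_nhds hx)

/-! ### Mollification and weak gradients -/

theorem lintegral_enorm_normed (φ : ContDiffBump (0 : Sp N)) (x : Sp N) :
    ∫⁻ t, ‖φ.normed volume (x - t)‖ₑ = 1 := by
  rw [lintegral_sub_left_eq_self (fun t => ‖φ.normed volume t‖ₑ)]
  simp_rw [Real.enorm_of_nonneg (φ.nonneg_normed _)]
  rw [← ofReal_integral_eq_lintegral_ofReal φ.integrable_normed
    (Eventually.of_forall φ.nonneg_normed), φ.integral_normed, ENNReal.ofReal_one]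

theorem sq_lintegral_mul_le {α : Type*} [MeasurableSpace α] (μ : Measure α) {w g : α → ℝ≥0∞}
    (hw : Measurable w) (hg : Measurable g) :
    (∫⁻ x, w x * g x ∂μ) ^ 2 ≤ (∫⁻ x, w x ∂μ) * ∫⁻ x, w x * g x ^ 2 ∂μ := by
  have h := sq_lintegral_le (μ.withDensity w) hg.aemeasurable
  rw [lintegral_withDensity_eq_lintegral_mul _ hw hg,
    lintegral_withDensity_eq_lintegral_mul _ hw (hg.pow_const 2),
    withDensity_apply _ MeasurableSet.univ, Measure.restrict_univ] at h
  exact h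

/-- Mollification does not increase the `L²` norm. -/
theorem lintegral_sq_mollify_le (φ : ContDiffBump (0 : Sp N)) (s : Set (Sp N))
    {h : Sp N → ℝ≥0∞} (hh : Measurable h) :
    ∫⁻ x, (∫⁻ t in s, ‖φ.normed volume (x - t)‖ₑ * h t) ^ 2 ≤ ∫⁻ t in s, h t ^ 2 := by
  have hmass : ∀ x, ∫⁻ t, ‖φ.normed volume (x - t)‖ₑ = 1 := lintegral_enorm_normed φ
  -- The kernel has mass one in `t`, as Jensen's inequality requires; its symmetry gives mass one in
  -- `x`, as required after Tonelli.
  have hsymm : ∀ x t, ‖φ.normed volume (x - t)‖ₑ = ‖φ.normed volume (t - x)‖ₑ := fun x t => by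
    rw [← neg_sub, ContDiffBump.normed_neg]
  have hm : Measurable fun x => ‖φ.normed volume x‖ₑ :=
    (φ.continuous_normed (μ := volume)).enorm.measurable
  have key : ∀ w : Sp N → ℝ≥0∞, Measurable w → (∀ x, ∫⁻ t, w (x - t) = 1) →
      (∀ x t, w (x - t) = w (t - x)) →
      ∫⁻ x, (∫⁻ t in s, w (x - t) * h t) ^ 2 ≤ ∫⁻ t in s, h t ^ 2 := by
    intro w hm hmass hsymm
    calc ∫⁻ x, (∫⁻ t in s, w (x - t) * h t) ^ 2
        ≤ ∫⁻ x, ∫⁻ t in s, w (x - t) * h t ^ 2 := by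
          refine lintegral_mono fun x => ?_
          refine (sq_lintegral_mul_le (volume.restrict s) (by fun_prop) hh).trans ?_
          refine (mul_le_mul_left ((setLIntegral_le_lintegral _ _).trans
            (hmass x).le) _).trans ?_
          rw [one_mul]
      _ = ∫⁻ t in s, ∫⁻ x, w (x - t) * h t ^ 2 :=
          lintegral_lintegral_swap (by fun_prop)
      _ = ∫⁻ t in s, h t ^ 2 := by
          refine lintegral_congr fun t => ?_
          rw [lintegral_mul_const _ (by fun_prop)]
          simp_rw [hsymm _ t, hmass, one_mul]
  exact key (fun x => ‖φ.normed volume x‖ₑ) hm hmass hsymm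

/-- The mollification of the extension of `f` by zero. -/
def mollify (Ω : Domain N) (φ : ContDiffBump (0 : Sp N)) (f : Sp N → ℝ) : Sp N → ℝ :=
  convolution (φ.normed volume) (Ω.carrier.indicator f) (lsmul ℝ ℝ) volume

theorem MemLp.locallyIntegrable_indicator {Ω : Domain N} {f : Sp N → ℝ}
    (hf : MemLp f 2 Ω.vol) : LocallyIntegrable (Ω.carrier.indicator f) :=
  ((integrable_indicator_iff Ω.isOpen.measurableSet).2
    (hf.integrable one_le_two)).locallyIntegrable

theorem contDiff_mollify {Ω : Domain N} (φ : ContDiffBump (0 : Sp N)) {f : Sp N → ℝ}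
    (hf : MemLp f 2 Ω.vol) : ContDiff ℝ 1 (mollify Ω φ f) :=
  φ.hasCompactSupport_normed.contDiff_convolution_left (n := 1) _ φ.contDiff_normed
    (MemLp.locallyIntegrable_indicator hf)

theorem mollify_apply (Ω : Domain N) (φ : ContDiffBump (0 : Sp N)) (f : Sp N → ℝ) (x : Sp N) :
    mollify Ω φ f x = ∫ t in Ω.carrier, φ.normed volume (x - t) * f t := by
  rw [mollify, convolution_eq_swap, ← integral_indicator Ω.isOpen.measurableSet]
  congr 1
  ext t
  by_cases ht : t ∈ Ω.carrier <;> simp [ht]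

theorem fderiv_mollify_apply {Ω : Domain N} (φ : ContDiffBump (0 : Sp N)) {f : Sp N → ℝ}
    (hf : MemLp f 2 Ω.vol) (x v : Sp N) :
    fderiv ℝ (mollify Ω φ f) x v
      = ∫ t in Ω.carrier, fderiv ℝ (φ.normed volume) (x - t) v * f t := by
  have hcd : ContDiff ℝ 1 (φ.normed (volume : Measure (Sp N))) := φ.contDiff_normed (n := 1)
  have hli := MemLp.locallyIntegrable_indicator hf
  have h := φ.hasCompactSupport_normed.hasFDerivAt_convolution_left (lsmul ℝ ℝ)
    (μ := (volume : Measure (Sp N))) hcd hli x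
  have hex := (φ.hasCompactSupport_normed.fderiv ℝ).convolutionExists_left
    ((lsmul ℝ ℝ : ℝ →L[ℝ] ℝ →L[ℝ] ℝ).precompL (Sp N)) (μ := (volume : Measure (Sp N)))
    (hcd.continuous_fderiv one_ne_zero) hli x
  have hex' : Integrable (fun t => ((lsmul ℝ ℝ : ℝ →L[ℝ] ℝ →L[ℝ] ℝ).precompL (Sp N))
      (fderiv ℝ (φ.normed volume) (x - t)) (Ω.carrier.indicator f t)) := hex.integrable_swap
  rw [mollify, h.fderiv, convolution_eq_swap, integral_apply hex',
    ← integral_indicator Ω.isOpen.measurableSet]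
  congr 1
  ext t
  by_cases ht : t ∈ Ω.carrier <;> simp [ht, precompL_apply]

/-- The support lies in the closed ball of radius `φ.rOut` about `x`, which is inside `Ω` by the
choice of `x`. Hence the translated kernel may be inserted in the definition of the weak derivative.
-/
theorem isTest_normed_sub {Ω : Domain N} (φ : ContDiffBump (0 : Sp N)) {x : Sp N}
    (hx : x ∈ innerSet Ω φ.rOut) : IsTest Ω fun t => φ.normed volume (x - t) := by
  have hts : tsupport (fun t => φ.normed (volume : Measure (Sp N)) (x - t))
      ⊆ Metric.closedBall x φ.rOut := by
    refine closure_minimal (fun t ht => ?_) Metric.isClosed_closedBall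
    have h : x - t ∈ Function.support (φ.normed (volume : Measure (Sp N))) := ht
    rw [φ.support_normed_eq, mem_ball_zero_iff] at h
    rw [Metric.mem_closedBall, dist_eq_norm, norm_sub_rev]
    exact h.le
  refine ⟨?_, (isCompact_closedBall x φ.rOut).of_isClosed_subset (isClosed_tsupport _) hts,
    hts.trans hx⟩
  exact (φ.contDiff_normed (n := ⊤)).comp (contDiff_const.sub contDiff_id)

/-- Away from the boundary the gradient of the mollification is the mollification of the
weak gradient. -/
theorem gradient_mollify {Ω : Domain N} (φ : ContDiffBump (0 : Sp N)) {f : Sp N → ℝ}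
    {G : Sp N → Sp N} (hf : MemLp f 2 Ω.vol) (hG : MemLp G 2 Ω.vol)
    (hw : ∀ i, IsWeakPartial Ω i f fun x => G x i) {x : Sp N} (hx : x ∈ innerSet Ω φ.rOut) :
    ∇ (mollify Ω φ f) x = ∫ t in Ω.carrier, φ.normed volume (x - t) • G t := by
  have htest := isTest_normed_sub φ hx
  have hi : Integrable (fun t => φ.normed volume (x - t) • G t) Ω.vol :=
    memLp_one_iff_integrable.1 (hG.smul htest.memLp)
  have hfd : ∀ t v : Sp N, fderiv ℝ (fun t => φ.normed volume (x - t)) t v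
      = -fderiv ℝ (φ.normed volume) (x - t) v := by
    intro t v
    have h1 : HasFDerivAt (fun t : Sp N => x - t) (-ContinuousLinearMap.id ℝ (Sp N)) t := by
      simpa using (hasFDerivAt_id t).const_sub x
    have h2 := (((φ.contDiff_normed (μ := volume) (n := 1)).differentiable one_ne_zero)
      (x - t)).hasFDerivAt.comp t h1
    rw [HasFDerivAt.fderiv (f := fun t => φ.normed volume (x - t)) h2]
    simp
  ext i
  have hL : (∇ (mollify Ω φ f) x) i
      = fderiv ℝ (mollify Ω φ f) x (EuclideanSpace.single i 1) := by
    rw [← InnerProductSpace.toDual_symm_apply, EuclideanSpace.inner_single_right]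
    simp [gradient]
  have hR : (∫ t in Ω.carrier, φ.normed volume (x - t) • G t) i
      = ∫ t in Ω.carrier, G t i * φ.normed volume (x - t) := by
    have := (EuclideanSpace.proj (𝕜 := ℝ) i : Sp N →L[ℝ] ℝ).integral_comp_comm hi
    refine this.symm.trans (integral_congr_ae (Eventually.of_forall fun t => ?_))
    exact mul_comm _ _
  -- The sign from differentiating `x - t` in `t` cancels the sign of the integration by parts.
  rw [hL, hR, fderiv_mollify_apply φ hf, ← neg_neg (∫ t in Ω.carrier, G t i * _),
    ← hw i _ htest, ← integral_neg]
  refine integral_congr_ae (Eventually.of_forall fun t => ?_)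
  simp only [hfd]
  ring

theorem lintegral_sq_mollify_enorm_le (Ω : Domain N) (φ : ContDiffBump (0 : Sp N))
    {f : Sp N → ℝ} (hf : Measurable f) :
    ∫⁻ x, ‖mollify Ω φ f x‖ₑ ^ 2 ≤ ∫⁻ x in Ω.carrier, ‖f x‖ₑ ^ 2 := by
  refine le_trans (lintegral_mono fun x => ?_) (lintegral_sq_mollify_le φ Ω.carrier hf.enorm)
  rw [mollify_apply]
  gcongr
  refine (enorm_integral_le_lintegral_enorm _).trans (le_of_eq ?_)
  simp only [enorm_mul]

/-- The left side is confined to the inner set because, near the boundary, the mollified extension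
by zero also sees the jump of `f`. -/
theorem lintegral_sq_fderiv_mollify_le {Ω : Domain N} (φ : ContDiffBump (0 : Sp N))
    {f : Sp N → ℝ} {G : Sp N → Sp N} (hf : MemLp f 2 Ω.vol) (hG : MemLp G 2 Ω.vol)
    (hGm : Measurable G) (hw : ∀ i, IsWeakPartial Ω i f fun x => G x i) :
    ∫⁻ x in innerSet Ω φ.rOut, ‖fderiv ℝ (mollify Ω φ f) x‖ₑ ^ 2
      ≤ ∫⁻ x in Ω.carrier, ‖G x‖ₑ ^ 2 := by
  refine le_trans (setLIntegral_mono' (isOpen_innerSet Ω _).measurableSet fun x hx => ?_)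
    ((setLIntegral_le_lintegral _ _).trans (lintegral_sq_mollify_le φ Ω.carrier hGm.enorm))
  have h : ‖fderiv ℝ (mollify Ω φ f) x‖ₑ = ‖∇ (mollify Ω φ f) x‖ₑ := by
    simp only [gradient, ← ofReal_norm, LinearIsometryEquiv.norm_map]
  rw [h, gradient_mollify φ hf hG hw hx]
  gcongr
  refine (enorm_integral_le_lintegral_enorm _).trans (le_of_eq ?_)
  simp only [enorm_smul]

/-! ### Passage to the limit: `H¹ ⊆ L⁴` -/

theorem Domain.dim_le (Ω : Domain N) : N ≤ 3 := by
  rcases Ω.dim with h | h <;> omega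

theorem tendsto_volume_innerSet (Ω : Domain N) :
    Tendsto (fun k : ℕ => volume (innerSet Ω (1 / ((k : ℝ) + 1)))) atTop
      (𝓝 (volume Ω.carrier)) := by
  have hU : ⋃ k : ℕ, innerSet Ω (1 / ((k : ℝ) + 1)) = Ω.carrier := by
    refine Subset.antisymm (iUnion_subset fun k => innerSet_subset Ω (by positivity)) ?_
    intro x hx
    obtain ⟨r, hr, hxr⟩ := exists_mem_innerSet Ω hx
    obtain ⟨k, hk⟩ := exists_nat_one_div_lt hr
    exact mem_iUnion.2 ⟨k, innerSet_anti Ω hk.le hxr⟩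
  rw [← hU]
  refine tendsto_measure_iUnion_atTop fun j k hjk => innerSet_anti Ω ?_
  exact Nat.one_div_le_one_div hjk

/-- The embedding `H¹(Ω) ⊆ L⁴(Ω)` for a bounded convex open set in dimension at most three. -/
theorem exists_lintegral_pow_four_le (Ω : Domain N) :
    ∃ C : ℝ≥0∞, C ≠ ⊤ ∧ ∀ (f : Sp N → ℝ) (G : Sp N → Sp N), Measurable f → Measurable G →
      MemLp f 2 Ω.vol → MemLp G 2 Ω.vol → (∀ i, IsWeakPartial Ω i f fun x => G x i) →
      ∫⁻ x in Ω.carrier, ‖f x‖ₑ ^ 4 ≤ C * ((∫⁻ x in Ω.carrier, ‖f x‖ₑ ^ 2) ^ 2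
        + (∫⁻ x in Ω.carrier, ‖G x‖ₑ ^ 2) ^ 2) := by
  obtain ⟨R, hR0, hR⟩ := Ω.isBounded.exists_pos_norm_le
  set V := volume Ω.carrier with hV
  have hVt : V ≠ ⊤ := Ω.isBounded.measure_lt_top.ne
  -- A null domain, such as the empty set, is treated apart because the constant below contains `(V
  -- ^ 4)⁻¹`.
  rcases eq_or_ne V 0 with hV0 | hV0
  · refine ⟨0, by simp, fun f G _ _ _ _ _ => ?_⟩
    rw [Measure.restrict_eq_zero.2 hV0]
    simp
  set d : ℝ≥0∞ := ENNReal.ofReal (2 * R)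
  have hd : ∀ x ∈ Ω.carrier, ∀ y ∈ Ω.carrier, ‖y - x‖ₑ ≤ d := fun x hx y hy => by
    rw [← ofReal_norm]
    refine ENNReal.ofReal_le_ofReal ((norm_sub_le y x).trans ?_)
    linarith [hR x hx, hR y hy]
  set M : ℝ≥0∞ := 8 * V ^ 3 * (1 + 3456 * d ^ 4)
  have hM : M ≠ ⊤ := by
    have : d ≠ ⊤ := ENNReal.ofReal_ne_top
    finiteness
  refine ⟨(V ^ 4)⁻¹ * M, by finiteness, fun f G hfm hGm hf hG hw => ?_⟩
  set A := ∫⁻ x in Ω.carrier, ‖f x‖ₑ ^ 2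
  set B := ∫⁻ x in Ω.carrier, ‖G x‖ₑ ^ 2
  set r : ℕ → ℝ := fun k => 1 / ((k : ℝ) + 1) with hr
  have hrpos : ∀ k, 0 < r k := fun k => by positivity
  have hr0 : Tendsto r atTop (𝓝 0) := tendsto_one_div_add_atTop_nhds_zero_nat
  set φ : ℕ → ContDiffBump (0 : Sp N) := fun k =>
    ⟨r k / 2, r k, half_pos (hrpos k), half_lt_self (hrpos k)⟩
  set K : ℕ → Set (Sp N) := fun k => innerSet Ω (r k)
  have hKm : ∀ k, MeasurableSet (K k) := fun k => (isOpen_innerSet Ω _).measurableSet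
  have hKsub : ∀ k, K k ⊆ Ω.carrier := fun k => innerSet_subset Ω (hrpos k).le
  set F : ℕ → Sp N → ℝ := fun k => mollify Ω (φ k) f
  set H : ℕ → Sp N → ℝ≥0∞ := fun k => (K k).indicator fun x => (volume (K k) * ‖F k x‖ₑ) ^ 4
  have hbound : ∀ k, ∫⁻ x in Ω.carrier, H k x ≤ M * (A ^ 2 + B ^ 2) := by
    intro k
    calc ∫⁻ x in Ω.carrier, H k x ≤ ∫⁻ x, H k x := setLIntegral_le_lintegral _ _
      _ = ∫⁻ x in K k, (volume (K k) * ‖F k x‖ₑ) ^ 4 := lintegral_indicator (hKm k) _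
      _ ≤ _ := lintegral_pow_four_le_of_contDiff Ω.dim_le (hKm k) (convex_innerSet Ω _)
          (fun x hx y hy => hd x (hKsub k hx) y (hKsub k hy)) (contDiff_mollify (φ k) hf)
      _ ≤ 8 * (V ^ 3 * A ^ 2 + d ^ 4 * (3456 * V ^ 3 * B ^ 2)) := by
          gcongr
          · exact measure_mono (hKsub k)
          · exact (setLIntegral_le_lintegral _ _).trans
              (lintegral_sq_mollify_enorm_le Ω (φ k) hfm)
          · exact measure_mono (hKsub k)
          · exact lintegral_sq_fderiv_mollify_le (φ k) hf hG hGm hw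
      _ = 8 * V ^ 3 * (1 * A ^ 2) + 8 * V ^ 3 * ((3456 * d ^ 4) * B ^ 2) := by ring
      _ ≤ 8 * V ^ 3 * ((1 + 3456 * d ^ 4) * A ^ 2)
          + 8 * V ^ 3 * ((1 + 3456 * d ^ 4) * B ^ 2) := by
          gcongr
          · exact le_self_add
          · exact le_add_self
      _ = _ := by simp only [M]; ring
  have hHm : ∀ k, Measurable (H k) := fun k =>
    Measurable.indicator (((contDiff_mollify (φ k) hf).continuous.enorm.measurable.const_mul
      _).pow_const 4) (hKm k)
  -- Mollifications converge almost everywhere, as the outer radii are at most twice the inner ones;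
  -- each point of `Ω` eventually lies in `K k`, and the volumes of the `K k` tend to `V`.
  have hlim : ∀ᵐ x ∂Ω.vol, Tendsto (fun k => H k x) atTop (𝓝 ((V * ‖f x‖ₑ) ^ 4)) := by
    have h1 := ContDiffBump.ae_convolution_tendsto_right_of_locallyIntegrable
      (μ := (volume : Measure (Sp N))) (φ := φ) (l := atTop) (K := 2) hr0
      (Eventually.of_forall fun k => by simp [φ]; linarith [hrpos k])
      (MemLp.locallyIntegrable_indicator hf)
    filter_upwards [ae_restrict_of_ae h1, ae_restrict_mem Ω.isOpen.measurableSet] with x hx hxΩ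
    rw [indicator_of_mem hxΩ] at hx
    obtain ⟨s, hs, hxs⟩ := exists_mem_innerSet Ω hxΩ
    have hev : ∀ᶠ k in atTop, (volume (K k) * ‖F k x‖ₑ) ^ 4 = H k x := by
      filter_upwards [hr0.eventually_le_const hs] with k hk
      have hxk : x ∈ K k := innerSet_anti Ω hk hxs
      simp only [H, indicator_of_mem hxk]
    refine Tendsto.congr' hev ?_
    refine ((ENNReal.continuous_pow 4).tendsto _).comp ?_
    exact ENNReal.Tendsto.mul (tendsto_volume_innerSet Ω) (Or.inr enorm_ne_top)
      ((continuous_enorm.tendsto _).comp hx) (Or.inr hVt)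
  have hfatou : V ^ 4 * ∫⁻ x in Ω.carrier, ‖f x‖ₑ ^ 4 ≤ M * (A ^ 2 + B ^ 2) := by
    rw [← lintegral_const_mul _ (hfm.enorm.pow_const 4)]
    calc ∫⁻ x in Ω.carrier, V ^ 4 * ‖f x‖ₑ ^ 4
        = ∫⁻ x in Ω.carrier, liminf (fun k => H k x) atTop := by
          refine lintegral_congr_ae ?_
          filter_upwards [hlim] with x hx
          rw [hx.liminf_eq, mul_pow]
      _ ≤ liminf (fun k => ∫⁻ x in Ω.carrier, H k x) atTop := lintegral_liminf_le hHm
      _ ≤ M * (A ^ 2 + B ^ 2) :=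
          (liminf_le_liminf (Eventually.of_forall hbound)).trans (liminf_const _).le
  have hV4 : V ^ 4 ≠ 0 := pow_ne_zero 4 hV0
  have hV4t : V ^ 4 ≠ ⊤ := by finiteness
  calc ∫⁻ x in Ω.carrier, ‖f x‖ₑ ^ 4
      = (V ^ 4)⁻¹ * (V ^ 4 * ∫⁻ x in Ω.carrier, ‖f x‖ₑ ^ 4) := by
        rw [← mul_assoc, ENNReal.inv_mul_cancel hV4 hV4t, one_mul]
    _ ≤ (V ^ 4)⁻¹ * (M * (A ^ 2 + B ^ 2)) := by gcongr
    _ = _ := (mul_assoc _ _ _).symm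

theorem eLpNorm_two_sq {E : Type*} [NormedAddCommGroup E] (μ : Measure (Sp N)) (f : Sp N → E) :
    eLpNorm f 2 μ ^ 2 = ∫⁻ x, ‖f x‖ₑ ^ 2 ∂μ := by
  simpa using eLpNorm_nnreal_pow_eq_lintegral (μ := μ) (f := f) (p := 2) two_ne_zero

theorem eLpNorm_four_pow {E : Type*} [NormedAddCommGroup E] (μ : Measure (Sp N))
    (f : Sp N → E) : eLpNorm f 4 μ ^ 4 = ∫⁻ x, ‖f x‖ₑ ^ 4 ∂μ := by
  have h := eLpNorm_nnreal_pow_eq_lintegral (μ := μ) (f := f) (p := 4) four_ne_zero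
  rw [show (((4 : NNReal) : ℝ)) = ((4 : ℕ) : ℝ) by norm_num] at h
  simpa only [ENNReal.rpow_natCast, show ((4 : NNReal) : ℝ≥0∞) = 4 from rfl] using h

theorem exists_eLpNorm_four_le (Ω : Domain N) :
    ∃ C : NNReal, ∀ (f : Sp N → ℝ) (G : Sp N → Sp N), Measurable f → Measurable G →
      MemLp f 2 Ω.vol → MemLp G 2 Ω.vol → (∀ i, IsWeakPartial Ω i f fun x => G x i) →
      eLpNorm f 4 Ω.vol ≤ C * (eLpNorm f 2 Ω.vol + eLpNorm G 2 Ω.vol) := by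
  obtain ⟨C, hC, h⟩ := exists_lintegral_pow_four_le Ω
  -- A number that is at least 1 and at least `C` has fourth power at least `C`, so no fourth root
  -- is needed.
  refine ⟨max 1 C.toNNReal, fun f G hfm hGm hf hG hw => ?_⟩
  have h1 := h f G hfm hGm hf hG hw
  rw [← eLpNorm_two_sq, ← eLpNorm_two_sq, ← eLpNorm_four_pow] at h1
  refine (ENNReal.pow_le_pow_left_iff four_ne_zero).1 (h1.trans ?_)
  rw [mul_pow]
  have hC' : C ≤ ((max 1 C.toNNReal : NNReal) : ℝ≥0∞) := by
    rw [← ENNReal.coe_toNNReal hC]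
    exact ENNReal.coe_le_coe.2 (by simp)
  have h1' : 1 ≤ ((max 1 C.toNNReal : NNReal) : ℝ≥0∞) :=
    ENNReal.one_le_coe_iff.2 (le_max_left _ _)
  gcongr
  · exact hC'.trans (le_self_pow₀ h1' four_ne_zero)
  · generalize eLpNorm f 2 Ω.vol = a
    generalize eLpNorm G 2 Ω.vol = b
    calc (a ^ 2) ^ 2 + (b ^ 2) ^ 2
        ≤ (a ^ 2) ^ 2 + (b ^ 2) ^ 2 + (4 * a ^ 3 * b + 6 * a ^ 2 * b ^ 2 + 4 * a * b ^ 3) :=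
          le_self_add
      _ = (a + b) ^ 4 := by ring

/-! ### Bounded operators between the spaces -/

theorem H1.isWeakPartial {Ω : Domain N} (f : H1 Ω) (i : Fin N) :
    IsWeakPartial Ω i f.val (fun x => f.grad x i) := f.2 i

theorem H2.isWeakPartial {Ω : Domain N} (f : H2 Ω) (i j : Fin N) :
    IsWeakPartial Ω j (fun x => f.grad x i) (fun x => f.hess x (i, j)) := f.2 i j

/-- The underlying function, as a bounded map `H¹(Ω) → L²(Ω)`. -/
def H1.valL (Ω : Domain N) : H1 Ω →L[ℝ] L2 Ω ℝ :=
  (WithLp.fstL 2 ℝ _ _).comp (h1Submodule Ω).subtypeL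

/-- The weak gradient, as a bounded map `H¹(Ω) → L²(Ω; ℝ^N)`. -/
def H1.gradL (Ω : Domain N) : H1 Ω →L[ℝ] L2 Ω (Sp N) :=
  (WithLp.sndL 2 ℝ _ _).comp (h1Submodule Ω).subtypeL

/-- The weak Hessian, as a bounded map on `H²(Ω)`. -/
def H2.hessL (Ω : Domain N) : H2 Ω →L[ℝ] L2 Ω (EuclideanSpace ℝ (Fin N × Fin N)) :=
  (WithLp.sndL 2 ℝ _ _).comp (h2Submodule Ω).subtypeL

/-- The Laplacian, as a bounded map `H²(Ω) → L²(Ω)`. -/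
def H2.laplacianL (Ω : Domain N) : H2 Ω →L[ℝ] L2 Ω ℝ :=
  ∑ i : Fin N, ((EuclideanSpace.proj (𝕜 := ℝ) (i, i)).compLpL 2 Ω.vol).comp (H2.hessL Ω)

theorem H2.laplacianL_apply {Ω : Domain N} (f : H2 Ω) : H2.laplacianL Ω f = f.laplacian := by
  rw [H2.laplacianL, sum_apply]
  rfl

/-- The inclusion `H¹₀(Ω) ⊆ H¹(Ω)` is bounded, by Poincaré's inequality. -/
theorem H10.exists_norm_toH1_le (Ω : Domain N) : ∃ C : ℝ, ∀ f, ‖H10.toH1 Ω f‖ ≤ C * ‖f‖ := by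
  obtain ⟨C, h⟩ := poincare Ω
  -- The `H¹` norm is at most `‖f‖_{L²} + ‖∇f‖_{L²}`, and Poincaré's inequality absorbs the first
  -- term.
  refine ⟨C + 1, fun f => ?_⟩
  have h1 := h (H10.toH1 Ω f) f.2
  have h2 : ‖f‖ = ‖(H10.toH1 Ω f).grad‖ := rfl
  rw [h2]
  have h3 : ‖H10.toH1 Ω f‖ ^ 2 = ‖(H10.toH1 Ω f).val‖ ^ 2 + ‖(H10.toH1 Ω f).grad‖ ^ 2 :=
    WithLp.prod_norm_sq_eq_of_L2 _
  refine (abs_le_of_sq_le_sq' (?_ : _ ≤ (‖(H10.toH1 Ω f).val‖ + ‖(H10.toH1 Ω f).grad‖) ^ 2)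
    (by positivity)).2.trans ?_
  · rw [h3]
    nlinarith [norm_nonneg (H10.toH1 Ω f).val, norm_nonneg (H10.toH1 Ω f).grad]
  · linarith

/-- The inclusion `H¹₀(Ω) ⊆ H¹(Ω)` as a bounded map. -/
def H10.toH1L (Ω : Domain N) : H10 Ω →L[ℝ] H1 Ω :=
  (H10.toH1 Ω).mkContinuousOfExistsBound (H10.exists_norm_toH1_le Ω)

/-! ### `L⁴` bounds on `H¹` and on gradients from `H²` -/

theorem Lp.eLpNorm_eq_enorm {Ω : Domain N} {V : Type} [NormedAddCommGroup V] (f : L2 Ω V) :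
    eLpNorm f 2 Ω.vol = ‖f‖ₑ := (Lp.enorm_def f).symm

theorem H1.exists_eLpNorm_val_le (Ω : Domain N) :
    ∃ C : NNReal, ∀ f : H1 Ω, eLpNorm f.val 4 Ω.vol ≤ C * ‖f‖ₑ := by
  obtain ⟨C, h⟩ := exists_eLpNorm_four_le Ω
  refine ⟨C * 2, fun f => ?_⟩
  refine (h f.val f.grad (Lp.stronglyMeasurable _).measurable
    (Lp.stronglyMeasurable _).measurable (Lp.memLp _) (Lp.memLp _) f.isWeakPartial).trans ?_
  rw [Lp.eLpNorm_eq_enorm, Lp.eLpNorm_eq_enorm]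
  have h1 : ‖f.val‖ₑ ≤ ‖f‖ₑ := WithLp.enorm_fst_le _ f.1
  have h2 : ‖f.grad‖ₑ ≤ ‖f‖ₑ := WithLp.enorm_snd_le _ f.1
  push_cast
  rw [mul_assoc, two_mul]
  gcongr

theorem EuclideanSpace.norm_le_sum_norm (x : Sp N) : ‖x‖ ≤ ∑ i, ‖x i‖ := by
  have h := (EuclideanSpace.basisFun (Fin N) ℝ).sum_repr x
  calc ‖x‖ = ‖∑ i, (EuclideanSpace.basisFun (Fin N) ℝ).repr x i
        • EuclideanSpace.basisFun (Fin N) ℝ i‖ := by rw [h]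
    _ ≤ ∑ i, ‖(EuclideanSpace.basisFun (Fin N) ℝ).repr x i
        • EuclideanSpace.basisFun (Fin N) ℝ i‖ := norm_sum_le _ _
    _ = ∑ i, ‖x i‖ := by simp [norm_smul]

/-- The `i`-th row of a matrix. -/
def rowL (i : Fin N) : EuclideanSpace ℝ (Fin N × Fin N) →L[ℝ] Sp N :=
  (EuclideanSpace.equiv (Fin N) ℝ).symm.toContinuousLinearMap.comp
    (ContinuousLinearMap.pi fun j => EuclideanSpace.proj (i, j))

theorem norm_rowL_le (i : Fin N) (A : EuclideanSpace ℝ (Fin N × Fin N)) : ‖rowL i A‖ ≤ ‖A‖ := by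
  refine le_of_sq_le_sq ?_ (norm_nonneg _)
  rw [EuclideanSpace.norm_sq_eq, EuclideanSpace.norm_sq_eq, Fintype.sum_prod_type]
  exact Finset.single_le_sum (f := fun i => ∑ j, ‖A (i, j)‖ ^ 2)
    (fun _ _ => by positivity) (Finset.mem_univ i)

/-- Each `∂ᵢf` has the `i`-th row of the Hessian as weak gradient, so the scalar embedding applies
to it. Summing the components gives the factor `N`. -/
theorem H2.exists_eLpNorm_grad_le (Ω : Domain N) :
    ∃ C : NNReal, ∀ f : H2 Ω, eLpNorm f.grad 4 Ω.vol ≤ C * ‖f‖ₑ := by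
  obtain ⟨C, h⟩ := exists_eLpNorm_four_le Ω
  refine ⟨N * (C * 2), fun f => ?_⟩
  have hgm : Measurable f.grad := (Lp.stronglyMeasurable _).measurable
  have hhm : Measurable f.hess := (Lp.stronglyMeasurable _).measurable
  have h1 : ‖f.grad‖ₑ ≤ ‖f‖ₑ := 
    (WithLp.enorm_snd_le _ f.1.fst.1).trans (WithLp.enorm_fst_le _ f.1)
  have h2 : ‖f.hess‖ₑ ≤ ‖f‖ₑ := WithLp.enorm_snd_le _ f.1
  have hcoord : ∀ i : Fin N, eLpNorm (fun x => f.grad x i) 4 Ω.vol ≤ C * 2 * ‖f‖ₑ := by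
    intro i
    have hp : Measurable fun x => f.grad x i :=
      (EuclideanSpace.proj (𝕜 := ℝ) i : Sp N →L[ℝ] ℝ).continuous.measurable.comp hgm
    refine (h _ (fun x => rowL i (f.hess x)) hp
      ((rowL i).continuous.measurable.comp hhm) (memLp_coord _ i)
      ((Lp.memLp f.hess).continuousLinearMap_comp (rowL i)) (f.isWeakPartial i)).trans ?_
    rw [mul_assoc, two_mul]
    gcongr
    · refine le_trans (eLpNorm_mono fun x => ?_) ((Lp.eLpNorm_eq_enorm f.grad).trans_le h1)
      exact PiLp.norm_apply_le _ i
    · refine le_trans (eLpNorm_mono fun x => ?_) ((Lp.eLpNorm_eq_enorm f.hess).trans_le h2)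
      exact norm_rowL_le i _
  calc eLpNorm f.grad 4 Ω.vol ≤ eLpNorm (∑ i, fun x => ‖f.grad x i‖) 4 Ω.vol := by
        refine eLpNorm_mono fun x => ?_
        rw [Finset.sum_apply]
        exact (EuclideanSpace.norm_le_sum_norm _).trans (le_abs_self _)
    _ ≤ ∑ i, eLpNorm (fun x => ‖f.grad x i‖) 4 Ω.vol :=
        eLpNorm_sum_le (fun i _ => (((EuclideanSpace.proj (𝕜 := ℝ) i :
          Sp N →L[ℝ] ℝ).continuous.measurable.comp hgm).norm).aestronglyMeasurable)
          (by norm_num)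
    _ ≤ ∑ _i : Fin N, C * 2 * ‖f‖ₑ := by
        refine Finset.sum_le_sum fun i _ => ?_
        rw [eLpNorm_norm]
        exact hcoord i
    _ = _ := by simp [mul_assoc]

/-! ### The bounded product `n ∇w`, and the divergence operator -/

instance instHolderTripleFourFourTwo : ENNReal.HolderTriple 4 4 2 where
  inv_add_inv_eq_inv := by
    rw [← two_mul, show (4 : ℝ≥0∞) = 2 * 2 by norm_num,
      ENNReal.mul_inv (by simp) (by simp), ← mul_assoc, ENNReal.mul_inv_cancel (by simp) (by simp),
      one_mul]

theorem memLp_val_smul_grad {Ω : Domain N} (n : H1 Ω) (w : H2 Ω) :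
    MemLp (fun x => n.val x • w.grad x) 2 Ω.vol := by
  obtain ⟨C, hC⟩ := H1.exists_eLpNorm_val_le Ω
  obtain ⟨C', hC'⟩ := H2.exists_eLpNorm_grad_le Ω
  have h1 : MemLp n.val 4 Ω.vol :=
    ⟨Lp.aestronglyMeasurable _, (hC n).trans_lt (by finiteness)⟩
  have h2 : MemLp w.grad 4 Ω.vol :=
    ⟨Lp.aestronglyMeasurable _, (hC' w).trans_lt (by finiteness)⟩
  exact h2.smul h1

theorem H1.coeFn_val_add {Ω : Domain N} (f g : H1 Ω) :
    ⇑(f + g).val =ᵐ[Ω.vol] fun x => f.val x + g.val x := Lp.coeFn_add f.val g.val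

theorem H1.coeFn_val_smul {Ω : Domain N} (c : ℝ) (f : H1 Ω) :
    ⇑(c • f).val =ᵐ[Ω.vol] fun x => c * f.val x := Lp.coeFn_smul c f.val

theorem H2.coeFn_grad_add {Ω : Domain N} (f g : H2 Ω) :
    ⇑(f + g).grad =ᵐ[Ω.vol] fun x => f.grad x + g.grad x := Lp.coeFn_add f.grad g.grad

theorem H2.coeFn_grad_smul {Ω : Domain N} (c : ℝ) (f : H2 Ω) :
    ⇑(c • f).grad =ᵐ[Ω.vol] fun x => c • f.grad x := Lp.coeFn_smul c f.grad

/-- The bilinear map `(n, w) ↦ n ∇w`. -/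
def mulGradₗ (Ω : Domain N) : H1 Ω →ₗ[ℝ] H2 Ω →ₗ[ℝ] L2 Ω (Sp N) :=
  LinearMap.mk₂ ℝ (fun n w => (memLp_val_smul_grad n w).toLp _)
    (fun m n w => by
      rw [← MemLp.toLp_add, MemLp.toLp_eq_toLp_iff]
      filter_upwards [H1.coeFn_val_add m n] with x hx
      simp only [hx, Pi.add_apply, add_smul])
    (fun c n w => by
      rw [← MemLp.toLp_const_smul, MemLp.toLp_eq_toLp_iff]
      filter_upwards [H1.coeFn_val_smul c n] with x hx
      simp only [hx, Pi.smul_apply, mul_smul])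
    (fun n v w => by
      rw [← MemLp.toLp_add, MemLp.toLp_eq_toLp_iff]
      filter_upwards [H2.coeFn_grad_add v w] with x hx
      simp only [hx, Pi.add_apply, smul_add])
    (fun c n w => by
      rw [← MemLp.toLp_const_smul, MemLp.toLp_eq_toLp_iff]
      filter_upwards [H2.coeFn_grad_smul c w] with x hx
      simp only [hx, Pi.smul_apply]
      rw [smul_comm])

theorem mulGradₗ_apply {Ω : Domain N} (n : H1 Ω) (w : H2 Ω) :
    mulGradₗ Ω n w = (memLp_val_smul_grad n w).toLp _ := rfl

theorem exists_norm_mulGradₗ_le (Ω : Domain N) :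
    ∃ C : ℝ, ∀ n w, ‖mulGradₗ Ω n w‖ ≤ C * ‖n‖ * ‖w‖ := by
  obtain ⟨C, hC⟩ := H1.exists_eLpNorm_val_le Ω
  obtain ⟨C', hC'⟩ := H2.exists_eLpNorm_grad_le Ω
  refine ⟨C * C', fun n w => ?_⟩
  have h : ‖mulGradₗ Ω n w‖ₑ ≤ (C * ‖n‖ₑ) * (C' * ‖w‖ₑ) := by
    rw [mulGradₗ_apply, Lp.enorm_toLp]
    have h4 : eLpNorm (⇑n.val • ⇑w.grad) 2 Ω.vol
        ≤ eLpNorm n.val 4 Ω.vol * eLpNorm w.grad 4 Ω.vol :=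
      eLpNorm_smul_le_mul_eLpNorm (Lp.aestronglyMeasurable _) (Lp.aestronglyMeasurable _)
    exact h4.trans (mul_le_mul' (hC n) (hC' w))
  have h2 := ENNReal.toReal_mono (by finiteness) h
  simp only [ENNReal.toReal_mul, toReal_enorm, ENNReal.coe_toReal] at h2
  linarith

/-- The bounded bilinear map `H¹(Ω) × H²(Ω) → L²(Ω; ℝ^N)`, `(n, w) ↦ n ∇w`. -/
def mulGrad (Ω : Domain N) : H1 Ω →L[ℝ] H2 Ω →L[ℝ] L2 Ω (Sp N) :=
  (mulGradₗ Ω).mkContinuousOfExistsBound₂ (exists_norm_mulGradₗ_le Ω)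

theorem coeFn_mulGrad {Ω : Domain N} (n : H1 Ω) (w : H2 Ω) :
    ⇑(mulGrad Ω n w) =ᵐ[Ω.vol] fun x => n.val x • w.grad x :=
  (memLp_val_smul_grad n w).coeFn_toLp

/-- The operator `-∇· : L²(Ω; ℝ^N) → H⁻¹(Ω)`. -/
def negDivL (Ω : Domain N) : L2 Ω (Sp N) →L[ℝ] HNeg1 Ω :=
  ((compL ℝ (H10 Ω) (L2 Ω (Sp N)) ℝ).flip
    (H10.gradIsometry Ω).toContinuousLinearMap).comp (innerSL ℝ)

/-- This links pointwise fields to the linear operator on classes. Agreement with an `L²` class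
makes `V` square integrable, which rules out the default value 0 of `negDiv`. -/
theorem negDivL_apply {Ω : Domain N} {V : Sp N → Sp N} {W : L2 Ω (Sp N)} (h : W =ᵐ[Ω.vol] V) :
    negDivL Ω W = negDiv Ω V := by
  have hV : MemLp V 2 Ω.vol := (memLp_congr_ae h).1 (Lp.memLp W)
  have hW : hV.toLp V = W := Lp.ext (hV.coeFn_toLp.trans h.symm)
  rw [negDiv, dif_pos hV, hW]
  rfl

/-! ### The drift-diffusion map -/

/-- The component `h ↦ ρ`. -/
def rhoL (Ω : Domain N) : HSpace Ω →L[ℝ] H2 Ω :=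
  (h20Submodule Ω).subtypeL.comp (fst ℝ (H20 Ω) (H10 Ω × H10 Ω))

/-- The component `h ↦ σ`, with values in `H¹(Ω)`. -/
def sigmaL (Ω : Domain N) : HSpace Ω →L[ℝ] H1 Ω :=
  (H10.toH1L Ω).comp ((fst ℝ (H10 Ω) (H10 Ω)).comp (snd ℝ (H20 Ω) (H10 Ω × H10 Ω)))

/-- The component `h ↦ τ`, with values in `H¹(Ω)`. -/
def tauL (Ω : Domain N) : HSpace Ω →L[ℝ] H1 Ω :=
  (H10.toH1L Ω).comp ((snd ℝ (H10 Ω) (H10 Ω)).comp (snd ℝ (H20 Ω) (H10 Ω × H10 Ω)))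

/-- The functional `-∇·(d ∇n + c n ∇w)`. -/
def flux (Ω : Domain N) (d c : ℝ) (n : H1 Ω) (w : H2 Ω) : HNeg1 Ω :=
  negDivL Ω (d • H1.gradL Ω n + c • mulGrad Ω n w)

/-- The derivative of `flux` along the affine maps with linear parts `s` and `rhoL`. -/
def flux' (Ω : Domain N) (d c : ℝ) (s : HSpace Ω →L[ℝ] H1 Ω) (n : H1 Ω) (w : H2 Ω) :
    HSpace Ω →L[ℝ] HNeg1 Ω :=
  (negDivL Ω).comp (d • (H1.gradL Ω).comp s
    + c • ((mulGrad Ω n).comp (rhoL Ω) + ((mulGrad Ω).flip w).comp s))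

/-! ### Calculus of affine plus bilinear maps -/

section Bilinear

variable {X A B C Z : Type*} [NormedAddCommGroup X] [NormedSpace ℝ X]
  [NormedAddCommGroup A] [NormedSpace ℝ A] [NormedAddCommGroup B] [NormedSpace ℝ B]
  [NormedAddCommGroup C] [NormedSpace ℝ C] [NormedAddCommGroup Z] [NormedSpace ℝ Z]
  (T : C →L[ℝ] Z) (L : A →L[ℝ] C) (M : A →L[ℝ] B →L[ℝ] C) (s : X →L[ℝ] A) (r : X →L[ℝ] B)

/-- The product rule for a bounded bilinear map. Both fluxes have this form and differ only in the
coefficients, the shift `a` and the linear map `s`. -/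
theorem hasFDerivAt_comp_linear_add_bilinear (d c : ℝ) (a : A) (b : B) (h : X) :
    HasFDerivAt (fun k => T (d • L (s k + a) + c • M (s k + a) (r k + b)))
      (T.comp (d • L.comp s + c • ((M (s h + a)).comp r + (M.flip (r h + b)).comp s))) h := by
  have hs : HasFDerivAt (fun k => s k + a) s h := s.hasFDerivAt.add_const a
  have hr : HasFDerivAt (fun k => r k + b) r h := r.hasFDerivAt.add_const b
  have hm : HasFDerivAt (fun k => M (s k + a) (r k + b))
      ((M (s h + a)).comp r + (M.flip (r h + b)).comp s) h := by
    refine (M.hasFDerivAt_of_bilinear hs hr).congr_fderiv ?_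
    ext1 k
    rfl
  exact T.hasFDerivAt.comp h (((L.hasFDerivAt.comp h hs).const_smul d).add (hm.const_smul c))

theorem continuous_clm_prod {Y : Type*} [TopologicalSpace Y] {f : Y → X →L[ℝ] A}
    {g : Y → X →L[ℝ] B} (hf : Continuous f) (hg : Continuous g) :
    Continuous fun y => (f y).prod (g y) :=
  (prodₗᵢ ℝ : _ ≃ₗᵢ[ℝ] (X →L[ℝ] A × B)).continuous.comp (hf.prodMk hg)

/-- The derivative of a quadratic map is affine in the base point: `k` enters only through the
bounded maps `M` and `M.flip`, and composition of operators is continuous in norm. -/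
theorem continuous_comp_linear_add_bilinear (d c : ℝ) (a : A) (b : B) :
    Continuous fun k : X =>
      T.comp (d • L.comp s + c • ((M (s k + a)).comp r + (M.flip (r k + b)).comp s)) := by
  refine continuous_const.clm_comp (continuous_const.add (Continuous.const_smul ?_ c))
  exact ((M.continuous.comp (s.continuous.add continuous_const)).clm_comp continuous_const).add
    ((M.flip.continuous.comp (r.continuous.add continuous_const)).clm_comp continuous_const)

/-- Joint continuity of a derivative whose components are affine in the parameters. -/
theorem continuous_prod_comp_linear_add_bilinear {W : Type*} [NormedAddCommGroup W]
    [NormedSpace ℝ W] (U V : X →L[ℝ] W) (s₁ s₂ : X →L[ℝ] A) (d₁ c₁ d₂ c₂ : ℝ) (a₁ a₂ : A)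
    (b : B) :
    Continuous fun q : X × unitInterval => (U + (q.2 : ℝ) • V).prod
      ((T.comp (d₁ • L.comp s₁
        + c₁ • ((M (s₁ q.1 + a₁)).comp r + (M.flip (r q.1 + b)).comp s₁))).prod
      (T.comp (d₂ • L.comp s₂
        + c₂ • ((M (s₂ q.1 + a₂)).comp r + (M.flip (r q.1 + b)).comp s₂)))) :=
  continuous_clm_prod (by fun_prop) (continuous_clm_prod
    ((continuous_comp_linear_add_bilinear T L M s₁ r d₁ c₁ a₁ b).comp continuous_fst)
    ((continuous_comp_linear_add_bilinear T L M s₂ r d₂ c₂ a₂ b).comp continuous_fst))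

end Bilinear

theorem hasFDerivAt_flux {Ω : Domain N} (d c : ℝ) (s : HSpace Ω →L[ℝ] H1 Ω) (a : H1 Ω)
    (b : H2 Ω) (h : HSpace Ω) :
    HasFDerivAt (fun k => flux Ω d c (s k + a) (rhoL Ω k + b))
      (flux' Ω d c s (s h + a) (rhoL Ω h + b)) h :=
  hasFDerivAt_comp_linear_add_bilinear (negDivL Ω) (H1.gradL Ω) (mulGrad Ω) s (rhoL Ω) d c a b h

theorem H1.coeFn_gradL_add_mulGrad {Ω : Domain N} (d c : ℝ) (n : H1 Ω) (w : H2 Ω) :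
    ⇑(d • H1.gradL Ω n + c • mulGrad Ω n w)
      =ᵐ[Ω.vol] fun x => d • n.grad x + (c * n.val x) • w.grad x := by
  filter_upwards [Lp.coeFn_add (d • H1.gradL Ω n) (c • mulGrad Ω n w),
    Lp.coeFn_smul d (H1.gradL Ω n), Lp.coeFn_smul c (mulGrad Ω n w), coeFn_mulGrad n w]
    with x h1 h2 h3 h4
  rw [h1, Pi.add_apply, h2, h3, Pi.smul_apply, Pi.smul_apply, h4, mul_smul]
  rfl

theorem H1.coeFn_gradL_add_mulGrad_add {Ω : Domain N} (d c : ℝ) (m n : H1 Ω) (v w : H2 Ω) :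
    ⇑(d • H1.gradL Ω m + c • (mulGrad Ω n v + mulGrad Ω m w))
      =ᵐ[Ω.vol] fun x => d • m.grad x + (c * m.val x) • w.grad x + (c * n.val x) • v.grad x := by
  filter_upwards [Lp.coeFn_add (d • H1.gradL Ω m) (c • (mulGrad Ω n v + mulGrad Ω m w)),
    Lp.coeFn_smul d (H1.gradL Ω m), Lp.coeFn_smul c (mulGrad Ω n v + mulGrad Ω m w),
    Lp.coeFn_add (mulGrad Ω n v) (mulGrad Ω m w), coeFn_mulGrad n v, coeFn_mulGrad m w]
    with x h1 h2 h3 h4 h5 h6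
  rw [h1, Pi.add_apply, h2, h3, Pi.smul_apply, Pi.smul_apply, h4, Pi.add_apply, h5, h6,
    smul_add, mul_smul, mul_smul, add_assoc, add_comm (c • n.val x • v.grad x)]
  rfl

theorem MemLp.integrable_inner_grad {Ω : Domain N} {V : Sp N → Sp N} (hV : MemLp V 2 Ω.vol)
    (φ : H10 Ω) : Integrable (fun x => ⟪V x, φ.grad x⟫_ℝ) Ω.vol := by
  refine (L2.integrable_inner (𝕜 := ℝ) (hV.toLp V) φ.grad).congr ?_
  filter_upwards [hV.coeFn_toLp] with x hx
  rw [hx]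

/-! ### Identification of `F` and of its derivative -/

namespace Data

variable {Ω : Domain N} (P : Data Ω)

theorem coeFn_fluxN (h : HSpace Ω) :
    ⇑(P.dn • H1.gradL Ω (P.n h) + (-P.cn) • mulGrad Ω (P.n h) (P.u h)) =ᵐ[Ω.vol] P.fluxN h := by
  refine (H1.coeFn_gradL_add_mulGrad _ _ _ _).trans (Eventually.of_forall fun x => ?_)
  simp only [fluxN, neg_mul, neg_smul, sub_eq_add_neg]

theorem coeFn_fluxP (h : HSpace Ω) :
    ⇑(P.dp • H1.gradL Ω (P.p h) + P.cp • mulGrad Ω (P.p h) (P.u h)) =ᵐ[Ω.vol] P.fluxP h :=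
  H1.coeFn_gradL_add_mulGrad _ _ _ _

theorem coeFn_fluxN' (h h' : HSpace Ω) :
    ⇑(P.dn • H1.gradL Ω (sigmaL Ω h') + (-P.cn) • (mulGrad Ω (P.n h) (rhoL Ω h')
      + mulGrad Ω (sigmaL Ω h') (P.u h))) =ᵐ[Ω.vol] P.fluxN' h h' := by
  refine (H1.coeFn_gradL_add_mulGrad_add _ _ _ _ _ _).trans (Eventually.of_forall fun x => ?_)
  simp only [fluxN', neg_mul, neg_smul, sub_eq_add_neg]
  rfl

theorem coeFn_fluxP' (h h' : HSpace Ω) :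
    ⇑(P.dp • H1.gradL Ω (tauL Ω h') + P.cp • (mulGrad Ω (P.p h) (rhoL Ω h')
      + mulGrad Ω (tauL Ω h') (P.u h))) =ᵐ[Ω.vol] P.fluxP' h h' :=
  H1.coeFn_gradL_add_mulGrad_add _ _ _ _ _ _

theorem memLp_fluxN (h : HSpace Ω) : MemLp (P.fluxN h) 2 Ω.vol :=
  (memLp_congr_ae (P.coeFn_fluxN h)).1 (Lp.memLp _)

theorem memLp_fluxP (h : HSpace Ω) : MemLp (P.fluxP h) 2 Ω.vol :=
  (memLp_congr_ae (P.coeFn_fluxP h)).1 (Lp.memLp _)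

theorem memLp_fluxN' (h h' : HSpace Ω) : MemLp (P.fluxN' h h') 2 Ω.vol :=
  (memLp_congr_ae (P.coeFn_fluxN' h h')).1 (Lp.memLp _)

theorem memLp_fluxP' (h h' : HSpace Ω) : MemLp (P.fluxP' h h') 2 Ω.vol :=
  (memLp_congr_ae (P.coeFn_fluxP' h h')).1 (Lp.memLp _)

/-- The derivative of the first component of `F`. -/
def poissonL (Ω : Domain N) (lam : ℝ) : HSpace Ω →L[ℝ] L2 Ω ℝ :=
  -((H2.laplacianL Ω).comp (rhoL Ω)) + lam • (H1.valL Ω).comp (sigmaL Ω - tauL Ω)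

/-- The derivative of `F(·, λ)` at `h`. -/
def DF (h : HSpace Ω) (lam : ℝ) : HSpace Ω →L[ℝ] GSpace Ω :=
  (poissonL Ω lam).prod ((flux' Ω P.dn (-P.cn) (sigmaL Ω) (P.n h) (P.u h)).prod
    (flux' Ω P.dp P.cp (tauL Ω) (P.p h) (P.u h)))

/-- Splitting off the data `a_u`, `a_n`, `a_p` and `D` displays the first component as linear plus
constant in `h`, and the other two as `flux` along affine maps. The drift sign is carried by the
coefficient, `-c_n` or `c_p`. -/
theorem F_eq (h : HSpace Ω) (lam : unitInterval) :
    P.F h lam = (poissonL Ω lam h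
        + (-H2.laplacianL Ω P.au + (lam : ℝ) • H1.valL Ω (P.an - P.ap) - P.D2),
      flux Ω P.dn (-P.cn) (sigmaL Ω h + P.an) (rhoL Ω h + P.au),
      flux Ω P.dp P.cp (tauL Ω h + P.ap) (rhoL Ω h + P.au)) := by
  refine Prod.ext ?_ (Prod.ext ?_ ?_)
  · change -(P.u h).laplacian + (lam : ℝ) • (H1.valL Ω (P.n h) - H1.valL Ω (P.p h)) - P.D2
      = (-(H2.laplacianL Ω (rhoL Ω h)) + (lam : ℝ) • H1.valL Ω (sigmaL Ω h - tauL Ω h))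
        + (-H2.laplacianL Ω P.au + (lam : ℝ) • H1.valL Ω (P.an - P.ap) - P.D2)
    rw [← H2.laplacianL_apply, show P.u h = rhoL Ω h + P.au from rfl,
      show P.n h = sigmaL Ω h + P.an from rfl, show P.p h = tauL Ω h + P.ap from rfl]
    simp only [map_add, map_sub, smul_add, smul_sub]
    abel
  · exact (negDivL_apply (P.coeFn_fluxN h)).symm
  · exact (negDivL_apply (P.coeFn_fluxP h)).symm

theorem hasFDerivAt_F (h : HSpace Ω) (lam : unitInterval) :
    HasFDerivAt (fun k => P.F k lam) (P.DF h lam) h := by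
  simp only [F_eq]
  exact ((poissonL Ω lam).hasFDerivAt.add_const _).prodMk
    ((hasFDerivAt_flux _ _ _ _ _ h).prodMk (hasFDerivAt_flux _ _ _ _ _ h))

/-- `Fh` is an `fderiv`, which is 0 by default where no derivative exists; existence is therefore
established first, and uniqueness of the derivative does the rest. -/
theorem Fh_eq (h : HSpace Ω) (lam : unitInterval) : P.Fh h lam = P.DF h lam :=
  (P.hasFDerivAt_F h lam).fderiv

set_option maxHeartbeats 1000000 in
theorem continuous_DF : Continuous fun q : HSpace Ω × unitInterval => P.DF q.1 q.2 :=
  continuous_prod_comp_linear_add_bilinear (negDivL Ω) (H1.gradL Ω) (mulGrad Ω) (rhoL Ω)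
    (-((H2.laplacianL Ω).comp (rhoL Ω))) ((H1.valL Ω).comp (sigmaL Ω - tauL Ω))
    (sigmaL Ω) (tauL Ω) P.dn (-P.cn) P.dp P.cp P.an P.ap P.au

theorem DF_apply_fst (h : HSpace Ω) (lam : ℝ) (h' : HSpace Ω) :
    (P.DF h lam h').1 = -(h'.1 : H2 Ω).laplacian + lam • (h'.2.1.val - h'.2.2.val) := by
  rw [← H2.laplacianL_apply]
  change -(H2.laplacianL Ω (rhoL Ω h')) + lam • H1.valL Ω (sigmaL Ω h' - tauL Ω h') = _
  rw [map_sub]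
  rfl

theorem DF_apply_snd_fst (h : HSpace Ω) (lam : ℝ) (h' : HSpace Ω) :
    (P.DF h lam h').2.1 = negDiv Ω (P.fluxN' h h') :=
  negDivL_apply (P.coeFn_fluxN' h h')

theorem DF_apply_snd_snd (h : HSpace Ω) (lam : ℝ) (h' : HSpace Ω) :
    (P.DF h lam h').2.2 = negDiv Ω (P.fluxP' h h') :=
  negDivL_apply (P.coeFn_fluxP' h h')

end Data

end DriftDiffusion

end

theorem mainTheorem6 {N : ℕ} (Ω : DriftDiffusion.Domain N) (P : DriftDiffusion.Data Ω) :
    -- `F` is well defined: the fluxes are of class `L²`, and `F₂`, `F₃` act by integration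
    (∀ (h : DriftDiffusion.HSpace Ω) (lam : unitInterval),
      MemLp (P.fluxN h) 2 Ω.vol ∧ MemLp (P.fluxP h) 2 Ω.vol ∧
      (∀ φ : DriftDiffusion.H10 Ω,
        Integrable (fun x => ⟪P.fluxN h x, φ.grad x⟫_ℝ) Ω.vol ∧
        (P.F h lam).2.1 φ = ∫ x in Ω.carrier, ⟪P.fluxN h x, φ.grad x⟫_ℝ) ∧
      (∀ ψ : DriftDiffusion.H10 Ω,
        Integrable (fun x => ⟪P.fluxP h x, ψ.grad x⟫_ℝ) Ω.vol ∧
        (P.F h lam).2.2 ψ = ∫ x in Ω.carrier, ⟪P.fluxP h x, ψ.grad x⟫_ℝ)) ∧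
    -- `F_h` exists as a Fréchet derivative
    (∀ (h : DriftDiffusion.HSpace Ω) (lam : unitInterval),
      HasFDerivAt (fun k => P.F k lam) (P.Fh h lam) h) ∧
    -- it is continuous in `(h, λ)` for the operator norm
    Continuous (fun q : DriftDiffusion.HSpace Ω × unitInterval => P.Fh q.1 q.2) ∧
    -- explicit formulas
    (∀ (h : DriftDiffusion.HSpace Ω) (lam : unitInterval) (h' : DriftDiffusion.HSpace Ω),
      (P.Fh h lam h').1
        = -(h'.1 : DriftDiffusion.H2 Ω).laplacian + (lam : ℝ) • (h'.2.1.val - h'.2.2.val) ∧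
      (∀ φ : DriftDiffusion.H10 Ω,
        Integrable (fun x => ⟪P.fluxN' h h' x, φ.grad x⟫_ℝ) Ω.vol ∧
        (P.Fh h lam h').2.1 φ = ∫ x in Ω.carrier, ⟪P.fluxN' h h' x, φ.grad x⟫_ℝ) ∧
      (∀ ψ : DriftDiffusion.H10 Ω,
        Integrable (fun x => ⟪P.fluxP' h h' x, ψ.grad x⟫_ℝ) Ω.vol ∧
        (P.Fh h lam h').2.2 ψ = ∫ x in Ω.carrier, ⟪P.fluxP' h h' x, ψ.grad x⟫_ℝ)) := by
  refine ⟨fun h lam => ⟨P.memLp_fluxN h, P.memLp_fluxP h, fun φ => ?_, fun ψ => ?_⟩,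
    fun h lam => ?_, ?_, fun h lam h' => ⟨?_, fun φ => ?_, fun ψ => ?_⟩⟩
  · exact ⟨DriftDiffusion.MemLp.integrable_inner_grad (P.memLp_fluxN h) φ,
      DriftDiffusion.negDiv_apply (P.memLp_fluxN h) φ⟩
  · exact ⟨DriftDiffusion.MemLp.integrable_inner_grad (P.memLp_fluxP h) ψ,
      DriftDiffusion.negDiv_apply (P.memLp_fluxP h) ψ⟩
  · rw [P.Fh_eq]
    exact P.hasFDerivAt_F h lam
  · simp only [P.Fh_eq]
    exact P.continuous_DF
  · rw [P.Fh_eq]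
    exact P.DF_apply_fst h lam h'
  · refine ⟨DriftDiffusion.MemLp.integrable_inner_grad (P.memLp_fluxN' h h') φ, ?_⟩
    rw [P.Fh_eq, P.DF_apply_snd_fst, DriftDiffusion.negDiv_apply (P.memLp_fluxN' h h')]
  · refine ⟨DriftDiffusion.MemLp.integrable_inner_grad (P.memLp_fluxP' h h') ψ, ?_⟩
    rw [P.Fh_eq, P.DF_apply_snd_snd, DriftDiffusion.negDiv_apply (P.memLp_fluxP' h h')]
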